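/- **Setting.** Consider an episodic POMDP with horizon $H\ge1$, latent states $\mathcal S$, observations $\mathcal O$, a finite action set $\mathcal A$ with $A=|\mathcal A|$, and known deterministic rewards $r_h=R_h(o_h,a_h)\ge 0$ with $\sum_{h=1}^H R_h(o_h,a_h)\le 1$ for all observations and actions. Fix $M\ge1$. Write $z_{h-1}$ for the last $\min\{h-1,M\}$ observation–action pairs before step $h$, and $\bar z_h=(z_{h-1},o_h)$. Let $\Pi$ be a finite nonempty set of $M$-memory policies $\pi=(\pi_h)$, where $\pi_h(\cdot\mid\bar z_h)$ is a distribution on $\mathcal A$. Let $\mathcal G$ be a finite set of functions $g=(g_1,\dots,g_H)$ of $\bar z_1,\dots,\bar z_H$, with $|g_h|\le B$ and the convention $g_{H+1}=0$. Let $V^\pi=\mathbb E_\pi[\sum_h r_h]$, $V^*=\max_{\pi\in\Pi}V^\pi$ and $V_h^\pi(z_{h-1},s_h)=\mathbb E_\pi[\sum_{h'\ge h}r_{h'}\mid z_{h-1},s_h]$. A value link function of $\pi$ is a $g$ with $\mathbb E[g_h(z_{h-1},o_h)\mid z_{h-1},s_h]=V^\pi_h(z_{h-1},s_h)$ for all $h,z_{h-1},s_h$.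 Assume that the model is in the *PO-bilinear class*: every $\pi\in\Pi$ has a value link function $g^\pi\in\mathcal G$, and there are a Hilbert space $\mathcal V$ and maps $W_h:\Pi\times\mathcal G\to\mathcal V$, $X_h:\Pi\to\mathcal V$ such that for all $\pi,\pi'\in\Pi$, $g\in\mathcal G$, $h\in[H]$, $$\mathbb E[r_h+g_{h+1}(\bar z_{h+1})-g_h(\bar z_h);\,a_{1:h-1}\sim\pi',a_h\sim\pi]=\langle W_h(\pi,g),X_h(\pi')\rangle,\qquad W_h(\pi,g^\pi)=0 .$$ For $f=(\pi,g)\in\mathcal H=\Pi\times\mathcal G$ put $\pi_f=\pi$, $V_f=\mathbb E[g_1(o_1)]$, and $l(f,\zeta_h)=A\,\pi_h(a_h\mid\bar z_h)\,(r_h+g_{h+1}(\bar z_{h+1}))-g_h(\bar z_h)$ for $\zeta_h=(\bar z_h,a_h,r_h,o_{h+1})$. Let $\pi_{\exp}(f,h)$ follow $\pi$ before step $h$ and draw $a_h$ uniformly from $\mathcal A$. Given $T$ and $\epsilon>0$, let $\mathrm{GEC}(\mathcal H,l^2,\Pi_{\exp},\epsilon)$ be the smallest $d\ge0$ such that for all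 $f^1,\dots,f^T\in\mathcal H$ $$\sum_{t=1}^T (V_{f^t}-V^{\pi_{f^t}})\le\Big[d\sum_{h=1}^H\sum_{t=1}^T\sum_{s=1}^{t-1}\big(\mathbb E_{\pi_{\exp}(f^s,h)}\,l(f^t,\zeta_h)\big)^2\Big]^{1/2}+2\min\{d,HT\}+\epsilon HT .$$ **Algorithm** (uniform prior $p^0$ on $\mathcal H$; parameters $T,N_{\mathrm{batch}},\gamma,\eta$). For $t=1,\dots,T$: draw $f^t=(\pi^t,g^t)$ from $$p^t(f)\propto p^0(f)\exp\Big(\gamma V_f-\eta\sum_{h=1}^H\sum_{s=1}^{t-1}\Big(\frac1{N_{\mathrm{batch}}}\sum_{i=1}^{N_{\mathrm{batch}}}l(f,\zeta^s_{i,h})\Big)^2\Big);$$ then, for each $h\in[H]$, execute $\pi_{\exp}(f^t,h)$ independently $N_{\mathrm{batch}}$ times and record the samples $\zeta^t_{i,h}$, $i\in[N_{\mathrm{batch}}]$. This takes $K=N_{\mathrm{batch}}TH$ episodes. Each of the $N_{\mathrm{batch}}H$ episodes of iteration $t$ is charged $V^*-V^{\pi^t}$, so $\mathrm{Reg}(K)=N_{\mathrm{batch}}H\sum_{t=1}^T(V^*-V^{\pi^t})$.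 **Theorem (PO-bilinear class).** For all $B>0$, $\kappa\ge1$ and $c>0$ there is a constant $C$, depending only on $B,\kappa,c$, such that the following holds in the above setting. Let $N_{\mathrm{batch}},T$ be positive integers, $K=N_{\mathrm{batch}}TH$, $d_{\mathrm{GEC}}=\mathrm{GEC}(\mathcal H,l^2,\Pi_{\exp},1/(HK))$ (assumed to exist) and $\iota=\log(|\mathcal G||\Pi|HK^2)$. Suppose that $d_{\mathrm{GEC}}\,A\,H\ge c$, that, up to a factor $\kappa$ (i.e. with ratio in $[\kappa^{-1},\kappa]$), $$N_{\mathrm{batch}}\approx\Big(\frac{A^2\iota}{d_{\mathrm{GEC}}H}\Big)^{1/3}K^{2/3},\qquad T\approx\Big(\frac{d_{\mathrm{GEC}}}{\iota A^2H^2}\Big)^{1/3}K^{1/3},$$ and that $\gamma=\eta=K^{1/3}\log(|\mathcal G||\Pi|)$. Then $$\mathbb E[\mathrm{Reg}(K)]\le C\,(d_{\mathrm{GEC}}\cdot A H K)^{2/3}\,\iota^{1/3}.$$ -/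

import Mathlib

open MeasureTheory ProbabilityTheory

universe u v w x

set_option synthInstance.maxSize 2000

noncomputable section

namespace POB

/-- The memory `z` available after `k` completed steps: the most recent `min k M`
observation-action pairs, oldest first. Steps are numbered from `0`, so `Mem O A M h × O` is the
space of the pairs (memory, current observation) on which the decision at step `h` is based. -/
abbrev Mem (O : Type u) (A : Type v) (M k : ℕ) : Type (max u v) := Fin (min k M) → O × A

/-- The empty memory. -/
def Mem.empty {O : Type u} {A : Type v} {M : ℕ} : Mem O A M 0 :=
  fun i => absurd i.2 (by simp)

/-- Append the pair `x` to the memory and keep the most recent `min (k + 1) M` pairs. -/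
def Mem.push {O : Type u} {A : Type v} {M k : ℕ} (z : Mem O A M k) (x : O × A) : Mem O A M (k + 1) :=
  fun i => (Fin.snoc z x : Fin (min k M + 1) → O × A)
    ⟨(min k M + 1 - min (k + 1) M) + i.1, by have := i.2; omega⟩

/-- An episodic partially observable Markov decision process with horizon `H`, latent states `S`,
observations `O`, actions `A` and known deterministic rewards. The steps are `0, …, H - 1`; the
components with an index beyond the horizon play no role. -/
structure POMDP (S : Type w) (O : Type u) (A : Type v) [MeasurableSpace S] [MeasurableSpace O] [MeasurableSpace A]
    (H : ℕ) where
  init : Measure S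
  trans : ℕ → Kernel (S × A) S
  emit : ℕ → Kernel S O
  reward : ℕ → O → A → ℝ
  init_prob : IsProbabilityMeasure init
  trans_markov : ∀ h, IsMarkovKernel (trans h)
  emit_markov : ∀ h, IsMarkovKernel (emit h)
  reward_meas : ∀ h, Measurable (fun p : O × A => reward h p.1 p.2)
  reward_nonneg : ∀ h o a, 0 ≤ reward h o a
  reward_sum_le : ∀ (o : ℕ → O) (a : ℕ → A), ∑ h ∈ Finset.range H, reward h (o h) (a h) ≤ 1

attribute [instance] POMDP.init_prob POMDP.trans_markov POMDP.emit_markov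

/-- An `M`-memory policy: at step `h` a distribution over actions that depends on the memory and
the current observation. -/
structure MemPolicy (O : Type u) (A : Type v) [MeasurableSpace O] [MeasurableSpace A] (M : ℕ) where
  act : (h : ℕ) → Kernel (Mem O A M h × O) A
  act_markov : ∀ h, IsMarkovKernel (act h)

attribute [instance] MemPolicy.act_markov

/-- A candidate value link function `g = (g_h)`, with `g_h = 0` beyond the horizon. -/
structure LinkFn (O : Type u) (A : Type v) [MeasurableSpace O] [MeasurableSpace A] (M H : ℕ) where
  val : (h : ℕ) → Mem O A M h × O → ℝ
  meas : ∀ h, Measurable (val h)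
  terminal : ∀ h, H ≤ h → ∀ z, val h z = 0

section Policies

variable {O : Type u} {A : Type v} [MeasurableSpace O] [MeasurableSpace A] {M : ℕ}

/-- Follow `π`, except that the action of step `h` is drawn from `ρ`. -/
def MemPolicy.splice (π : MemPolicy O A M) (h : ℕ) (ρ : MemPolicy O A M) : MemPolicy O A M where
  act k := if k = h then ρ.act k else π.act k
  act_markov k := by split_ifs <;> infer_instance

/-- The policy that always draws a uniformly random action. -/
def MemPolicy.unif (O : Type u) (A : Type v) [MeasurableSpace O] [MeasurableSpace A] [Fintype A] [Nonempty A]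
    (M : ℕ) : MemPolicy O A M where
  act _ := Kernel.const _ (PMF.uniformOfFintype A).toMeasure
  act_markov _ := inferInstance

/-- The exploration policy: follow `π`, but draw the action of step `h` uniformly. (How it behaves
after step `h` has no influence on the sample that is collected at step `h`.) -/
def MemPolicy.explore [Fintype A] [Nonempty A] (π : MemPolicy O A M) (h : ℕ) : MemPolicy O A M :=
  π.splice h (MemPolicy.unif O A M)

end Policies

/-- The sample `ζ_h = (z̄_h, a_h, r_h, o_{h+1})`, where `z̄_h = (z_{h-1}, o_h)`. -/
abbrev Sample (O : Type u) (A : Type v) (M h : ℕ) : Type (max u v) := (Mem O A M h × O) × A × ℝ × O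

/-- `z̄_{h+1}`, the memory and the observation of the next step, as a function of `ζ_h`. -/
def Sample.next {O : Type u} {A : Type v} {M h : ℕ} (ζ : Sample O A M h) : Mem O A M (h + 1) × O :=
  (ζ.1.1.push (ζ.1.2, ζ.2.1), ζ.2.2.2)

namespace POMDP

variable {S : Type w} {O : Type u} {A : Type v} [MeasurableSpace S] [MeasurableSpace O] [MeasurableSpace A] {H M : ℕ}

/-- One step of interaction: given the memory and the latent state at step `h`, the joint
distribution of the observation `o_h`, the action `a_h` and the next latent state. -/
def step (D : POMDP S O A H) (π : MemPolicy O A M) (h : ℕ) :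
    Kernel (Mem O A M h × S) ((O × A) × S) :=
  (((D.emit h).comap (fun p : Mem O A M h × S => p.2) measurable_snd) ⊗ₖ
    ((π.act h).comap (fun p : (Mem O A M h × S) × O => (p.1.1, p.2)) (by fun_prop))) ⊗ₖ
    ((D.trans h).comap (fun p : (Mem O A M h × S) × (O × A) => (p.1.2, p.2.2)) (by fun_prop))

/-- The law of the memory and the latent state at the beginning of step `h` under `π`. -/
def stateLaw (D : POMDP S O A H) (π : MemPolicy O A M) : (h : ℕ) → Measure (Mem O A M h × S)
  | 0 => (Measure.dirac Mem.empty).prod D.init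
  | h + 1 => (D.stateLaw π h ⊗ₘ D.step π h).map
      (fun p : (Mem O A M h × S) × ((O × A) × S) => (p.1.1.push p.2.1, p.2.2))

/-- The law of the sample `ζ_h` under `π`. (At the last step its final entry is the dummy
observation; it never matters, as link functions vanish beyond the horizon.) -/
def sampleLaw (D : POMDP S O A H) (π : MemPolicy O A M) (h : ℕ) : Measure (Sample O A M h) :=
  ((D.stateLaw π h ⊗ₘ D.step π h) ⊗ₘ
    ((D.emit (h + 1)).comap (fun p : (Mem O A M h × S) × ((O × A) × S) => p.2.2)
      (by fun_prop))).map
    (fun q => ((q.1.1.1, q.1.2.1.1), q.1.2.1.2, D.reward h q.1.2.1.1 q.1.2.1.2, q.2))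

/-- The value `V^π`, the expected total reward of an episode under `π`. -/
def value (D : POMDP S O A H) (π : MemPolicy O A M) : ℝ :=
  ∑ h ∈ Finset.range H, ∫ ζ, ζ.2.2.1 ∂(D.sampleLaw π h)

/-- The expected total reward of the `n` steps `h, …, h + n - 1` under `π`, started at step `h`
from a given memory and latent state. -/
def valueToGo (D : POMDP S O A H) (π : MemPolicy O A M) :
    (n h : ℕ) → Mem O A M h × S → ℝ
  | 0, _, _ => 0
  | n + 1, h, p => ∫ x, (D.reward h x.1.1 x.1.2 + D.valueToGo π n (h + 1) (p.1.push x.1, x.2))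
      ∂(D.step π h p)

/-- `g` is a value link function of `π`:
`E[g_h(z_{h-1}, o_h) | z_{h-1}, s_h] = V_h^π(z_{h-1}, s_h)` for all `h`, `z_{h-1}`, `s_h`. -/
def IsValueLink (D : POMDP S O A H) (π : MemPolicy O A M) (g : LinkFn O A M H) : Prop :=
  ∀ h < H, ∀ (z : Mem O A M h) (s : S),
    ∫ o, g.val h (z, o) ∂(D.emit h s) = D.valueToGo π (H - h) h (z, s)

/-- The PO-bilinear class, with Hilbert space `V`: the class `𝒢` contains a value link function
`g^π` of every `π ∈ Pol`, and the Bellman error of `(π, g)` at step `h`, when the actions before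
step `h` are drawn from `π'`, is the bilinear form `⟪W_h(π, g), X_h(π')⟫` with
`W_h(π, g^π) = 0`. -/
def IsPOBilinear (D : POMDP S O A H) (Pol : Finset (MemPolicy O A M))
    (𝒢 : Finset (LinkFn O A M H)) (V : Type x) [NormedAddCommGroup V] [InnerProductSpace ℝ V]
    [CompleteSpace V] : Prop :=
  ∃ (W : Fin H → MemPolicy O A M → LinkFn O A M H → V) (X : Fin H → MemPolicy O A M → V)
    (gπ : MemPolicy O A M → LinkFn O A M H),
    (∀ π ∈ Pol, gπ π ∈ 𝒢 ∧ D.IsValueLink π (gπ π)) ∧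
    (∀ π ∈ Pol, ∀ π' ∈ Pol, ∀ g ∈ 𝒢, ∀ h : Fin H,
      ∫ ζ, (ζ.2.2.1 + g.val (h + 1) ζ.next - g.val h ζ.1) ∂(D.sampleLaw (π'.splice h π) h)
        = inner ℝ (W h π g) (X h π')) ∧
    (∀ π ∈ Pol, ∀ h : Fin H, W h π (gπ π) = 0)

end POMDP

/-- The hypothesis class `Pol × 𝒢`, a finite (discrete) space. -/
def Hyp {O : Type u} {A : Type v} [MeasurableSpace O] [MeasurableSpace A] {M H : ℕ}
    (Pol : Finset (MemPolicy O A M)) (𝒢 : Finset (LinkFn O A M H)) : Type (max u v) := Pol × 𝒢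

/-- What is collected in one iteration: for every step `h`, a batch of `N` samples `ζ_h`. -/
abbrev Batch (O : Type u) (A : Type v) (M H N : ℕ) : Type (max u v) := (h : Fin H) → Fin N → Sample O A M h

/-- The first `t` iterations of a run: the sampled hypotheses and the collected batches. -/
abbrev Run {O : Type u} {A : Type v} [MeasurableSpace O] [MeasurableSpace A] {M H : ℕ}
    (Pol : Finset (MemPolicy O A M)) (𝒢 : Finset (LinkFn O A M H)) (N t : ℕ) : Type (max u v) :=
  Fin t → Hyp Pol 𝒢 × Batch O A M H N

section Algorithm

variable {S : Type w} {O : Type u} {A : Type v} [MeasurableSpace S] [MeasurableSpace O] [MeasurableSpace A]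
  {H M N : ℕ} {Pol : Finset (MemPolicy O A M)} {𝒢 : Finset (LinkFn O A M H)}

instance : MeasurableSpace (Hyp Pol 𝒢) := ⊤
instance : DiscreteMeasurableSpace (Hyp Pol 𝒢) := ⟨fun _ => trivial⟩
instance : Fintype (Hyp Pol 𝒢) := inferInstanceAs (Fintype (Pol × 𝒢))

/-- The policy component of a hypothesis. -/
def Hyp.pol (f : Hyp Pol 𝒢) : MemPolicy O A M := f.1.1

/-- The link function component of a hypothesis. -/
def Hyp.link (f : Hyp Pol 𝒢) : LinkFn O A M H := f.2.1

/-- The predicted value `V_f = E[g_1(o_1)]` of `f = (π, g)`. -/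
def Hyp.predValue (D : POMDP S O A H) (f : Hyp Pol 𝒢) : ℝ :=
  ∫ o, f.link.val 0 (Mem.empty, o) ∂(D.init.bind (D.emit 0))

/-- `l(f, ζ_h) = |A| π_h(a_h | z̄_h) (r_h + g_{h+1}(z̄_{h+1})) - g_h(z̄_h)`. -/
def loss [Fintype A] {h : ℕ} (f : Hyp Pol 𝒢) (ζ : Sample O A M h) : ℝ :=
  Fintype.card A * (f.pol.act h ζ.1).real {ζ.2.1} * (ζ.2.2.1 + f.link.val (h + 1) ζ.next)
    - f.link.val h ζ.1

/-- The unnormalised posterior weight of `f` given the first `t` iterations, with uniform prior: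
`p⁰(f) exp(γ V_f - η ∑_h ∑_s ((1/N) ∑_i l(f, ζ_{i,h}^s))²)`. -/
def weight [Fintype A] (D : POMDP S O A H) (γ η : ℝ) {t : ℕ} (ω : Run Pol 𝒢 N t)
    (f : Hyp Pol 𝒢) : ℝ :=
  (1 / (Fintype.card (Hyp Pol 𝒢) : ℝ)) * Real.exp (γ * f.predValue D +
    ∑ h : Fin H, -η * ∑ s : Fin t, ((1 / (N : ℝ)) * ∑ i : Fin N, loss f ((ω s).2 h i)) ^ 2)

theorem measurable_push {k : ℕ} :
    Measurable (fun p : Mem O A M k × (O × A) => p.1.push p.2) := by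
  refine measurable_pi_lambda _ fun i => ?_
  unfold Mem.push

  generalize (⟨(min k M + 1 - min (k + 1) M) + i.1, _⟩ : Fin (min k M + 1)) = j
  induction j using Fin.lastCases with
  | last => simpa using measurable_snd
  | cast j =>
    have h : Measurable fun p : Mem O A M k × (O × A) => p.1 j := by fun_prop
    simpa using h

theorem measurable_loss [Fintype A] [MeasurableSingletonClass A] {h : ℕ} (f : Hyp Pol 𝒢) :
    Measurable (loss (h := h) f) := by
  have h1 : Measurable (fun ζ : Sample O A M h => (f.pol.act h ζ.1).real {ζ.2.1}) := by
    have : Measurable (fun p : (Mem O A M h × O) × A => (f.pol.act h p.1).real {p.2}) :=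
      measurable_from_prod_countable_left fun a =>
        ((f.pol.act h).measurable_coe (measurableSet_singleton a)).ennreal_toReal
    exact this.comp (measurable_fst.prodMk (measurable_fst.comp measurable_snd))
  have h2 : Measurable (fun ζ : Sample O A M h => ζ.next) := by
    refine Measurable.prodMk ?_ (by fun_prop)
    exact measurable_push.comp (f := fun ζ : Sample O A M h => (ζ.1.1, (ζ.1.2, ζ.2.1)))
      (by fun_prop)
  unfold loss
  exact ((measurable_const.mul h1).mul
    (Measurable.add (by fun_prop) ((f.link.meas (h + 1)).comp h2))).sub
    ((f.link.meas h).comp measurable_fst)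

theorem measurable_weight [Fintype A] [MeasurableSingletonClass A] (D : POMDP S O A H)
    (γ η : ℝ) {t : ℕ} (f : Hyp Pol 𝒢) :
    Measurable (fun ω : Run Pol 𝒢 N t => weight D γ η ω f) := by
  unfold weight
  refine measurable_const.mul (Real.measurable_exp.comp (measurable_const.add ?_))
  refine Finset.measurable_sum _ fun h _ => measurable_const.mul
    (Finset.measurable_sum _ fun s _ => Measurable.pow_const (measurable_const.mul
    (Finset.measurable_sum _ fun i _ => (measurable_loss f).comp ?_)) 2)
  fun_prop

/-- The posterior `p^t`, as a function of the run up to that point. -/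
def posterior [Fintype A] [MeasurableSingletonClass A] (D : POMDP S O A H) (γ η : ℝ) (t : ℕ) :
    Kernel (Run Pol 𝒢 N t) (Hyp Pol 𝒢) where
  toFun ω := ∑ f, ENNReal.ofReal (weight D γ η ω f / ∑ f', weight D γ η ω f') • Measure.dirac f
  measurable' := by
    refine Measure.measurable_of_measurable_coe _ fun s _ => ?_
    simp only [Measure.coe_finsetSum, Finset.sum_apply, Measure.smul_apply, smul_eq_mul]
    exact Finset.measurable_sum _ fun f _ => (((measurable_weight D γ η f).div
      (Finset.measurable_sum _ fun f' _ => measurable_weight D γ η f')).ennreal_ofReal).mul_const _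

/-- Given the hypothesis `f = (π, g)`, for every step `h` the exploration policy of `π` and `h` is
executed `N` times, all executions being independent. -/
def batchLaw [Fintype A] [Nonempty A] (D : POMDP S O A H) :
    Kernel (Hyp Pol 𝒢) (Batch O A M H N) where
  toFun f := Measure.pi fun h : Fin H => Measure.pi fun _ : Fin N =>
    D.sampleLaw (f.pol.explore h) h
  measurable' := measurable_from_top

/-- One iteration of the algorithm: a hypothesis is drawn from the posterior and then a batch is
collected with it. -/
def iteration [Fintype A] [Nonempty A] [MeasurableSingletonClass A] (D : POMDP S O A H)
    (γ η : ℝ) (t : ℕ) : Kernel (Run Pol 𝒢 N t) (Hyp Pol 𝒢 × Batch O A M H N) :=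
  posterior D γ η t ⊗ₖ
    (batchLaw D).comap (fun p : Run Pol 𝒢 N t × Hyp Pol 𝒢 => p.2) measurable_snd

/-- The law of the first `t` iterations of the algorithm. -/
def runLaw [Fintype A] [Nonempty A] [MeasurableSingletonClass A] (D : POMDP S O A H)
    (Pol : Finset (MemPolicy O A M)) (𝒢 : Finset (LinkFn O A M H)) (N : ℕ) (γ η : ℝ) :
    (t : ℕ) → Measure (Run Pol 𝒢 N t)
  | 0 => Measure.dirac Fin.elim0
  | t + 1 => (runLaw D Pol 𝒢 N γ η t ⊗ₘ iteration D γ η t).map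
      (fun p => (Fin.snoc p.1 p.2 : Run Pol 𝒢 N (t + 1)))

/-- The optimal value `V^*` within the policy class. -/
def optValue (D : POMDP S O A H) (Pol : Finset (MemPolicy O A M)) : ℝ := ⨆ π : Pol, D.value π.1

/-- The regret of a run of `T` iterations, which takes `K = N T H` episodes: all `N H` episodes of
iteration `t` are charged with the suboptimality of the policy `π^t` of that iteration. -/
def regret (D : POMDP S O A H) {T : ℕ} (ω : Run Pol 𝒢 N T) : ℝ :=
  ∑ t : Fin T, ∑ _h : Fin H, ∑ _i : Fin N, (optValue D Pol - D.value (ω t).1.pol)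

/-- The expected regret of the algorithm after `T` iterations. -/
def expectedRegret [Fintype A] [Nonempty A] [MeasurableSingletonClass A] (D : POMDP S O A H)
    (Pol : Finset (MemPolicy O A M)) (𝒢 : Finset (LinkFn O A M H)) (N T : ℕ) (γ η : ℝ) : ℝ :=
  ∫ ω, regret D ω ∂(runLaw D Pol 𝒢 N γ η T)

/-- `d` is the generalized eluder coefficient (for sequences of length `T`, with burn-in cost
`2 min{d, HT} + ε H T`): the smallest `d ≥ 0` such that for all `f^1, …, f^T`,
`∑_t (V_{f^t} - V^{π^t}) ≤ (d ∑_h ∑_t ∑_{s < t} (E_{π_exp(f^s, h)} l(f^t, ζ_h))²)^{1/2}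
  + 2 min{d, HT} + ε H T`. -/
def IsGEC [Fintype A] [Nonempty A] (D : POMDP S O A H)
    (Pol : Finset (MemPolicy O A M)) (𝒢 : Finset (LinkFn O A M H)) (T : ℕ) (ε d : ℝ) : Prop :=
  IsLeast {d : ℝ | 0 ≤ d ∧ ∀ f : Fin T → Hyp Pol 𝒢,
    ∑ t, ((f t).predValue D - D.value (f t).pol) ≤
      Real.sqrt (d * ∑ h : Fin H, ∑ t, ∑ s ∈ Finset.Iio t,
        (∫ ζ, loss (f t) ζ ∂(D.sampleLaw ((f s).pol.explore h) h)) ^ 2)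
      + 2 * min d (H * T) + ε * H * T} d

end Algorithm

end POB

end

noncomputable section

namespace POB

/-! Let `f₀ = (π*, g^{π*})`, with `π*` optimal in the finite class. A value link function predicts
the value, so `V_{f₀} = V^*`. Importance weighting turns the mean of `l(f, ·)` under a uniform
action at step `h` into the Bellman error of `f`; for `f₀` this is an inner product with `W_h(π*,
g^{π*}) = 0`. Hence `f₀` predicts the optimum and has mean loss zero on all data
(`exists_optimal_hyp`).

Write `n = |Pol| |𝒢|`, and let `L_t(f)` be the cumulative squared empirical loss. As `γ = η`, the
posterior is a Gibbs measure with energy `γ (L_t(f) - V_f)`, so the Gibbs variational inequality,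
tested at `f₀`, gives `E_{p^t}[V^* - V_f + L_t(f)] ≤ L_t(f₀) + log n / γ`
(`integral_posterior_gap_le`). Since `f₀` has mean loss zero, `L_t(f₀)` is pure noise: it is at most
the sum of the earlier `deviation`s, the uniform squared errors of the empirical means. A
sub-Gaussian maximal inequality bounds each of these in expectation by `δ = 8 H b² (1 + log n) / N`,
with `b` the bound on the loss (`integral_iSup_sq_average_le`). Summing over `t`, the expected
`potential` is at most `T (T δ + log n / γ)` (`integral_potential_le`).

Along each run, the eluder inequality and AM-GM bound the summed suboptimality by `potential + T ∑
deviation + 5d/2 + ε H T`: half of the squared mean losses is paid by the squared empirical losses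
in the potential and by the deviations (`sum_value_gap_le`). Taking expectations and multiplying by
`N H` leaves `2 N H T² δ`, `K log n / γ`, `(5/2) N H d` and a term equal to `1`. The prescribed `N`
and `T` make the first and third of order `(d A H K)^{2/3} ι^{1/3}`; the second is `K^{2/3}`, which
`d A H ≥ c` absorbs together with the last (`regret_bound_le`). -/

theorem integrable_of_measurable_of_abs_le {α : Type*} [MeasurableSpace α] {μ : Measure α}
    [IsFiniteMeasure μ] {f : α → ℝ} {C : ℝ} (hf : Measurable f) (h : ∀ x, |f x| ≤ C) :
    Integrable f μ :=
  Integrable.of_bound hf.aestronglyMeasurable C (.of_forall h)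

theorem abs_integral_le_of_abs_le {α : Type*} [MeasurableSpace α] {μ : Measure α}
    [IsProbabilityMeasure μ] {f : α → ℝ} {C : ℝ} (h : ∀ x, |f x| ≤ C) : |∫ x, f x ∂μ| ≤ C := by
  simpa using norm_integral_le_of_norm_le_const (μ := μ) (f := f) (.of_forall h)

/-! ### Laws of states and samples, and importance weighting -/

namespace POMDP

variable {S : Type w} {O : Type u} {A : Type v} [MeasurableSpace S] [MeasurableSpace O]
  [MeasurableSpace A] {H M : ℕ}

instance (D : POMDP S O A H) (π : MemPolicy O A M) (h : ℕ) : IsMarkovKernel (D.step π h) := by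
  unfold step; infer_instance

theorem measurable_push_step {h : ℕ} : Measurable
    (fun p : (Mem O A M h × S) × ((O × A) × S) => (p.1.1.push p.2.1, p.2.2)) :=
  (measurable_push.comp (f := fun p : (Mem O A M h × S) × ((O × A) × S) => (p.1.1, p.2.1))
    (by fun_prop)).prodMk (by fun_prop)

instance (D : POMDP S O A H) (π : MemPolicy O A M) (h : ℕ) :
    IsProbabilityMeasure (D.stateLaw π h) := by
  induction h with
  | zero => unfold stateLaw; infer_instance
  | succ h ih => exact Measure.isProbabilityMeasure_map measurable_push_step.aemeasurable

theorem measurable_toSample (D : POMDP S O A H) (h : ℕ) : Measurable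
    (fun q : ((Mem O A M h × S) × ((O × A) × S)) × O =>
      (((q.1.1.1, q.1.2.1.1), q.1.2.1.2, D.reward h q.1.2.1.1 q.1.2.1.2, q.2) :
        Sample O A M h)) := by
  refine Measurable.prodMk (by fun_prop) (Measurable.prodMk (by fun_prop)
    (Measurable.prodMk ?_ (by fun_prop)))
  exact (D.reward_meas h).comp
    (f := fun q : ((Mem O A M h × S) × ((O × A) × S)) × O => q.1.2.1) (by fun_prop)

instance (D : POMDP S O A H) (π : MemPolicy O A M) (h : ℕ) :
    IsProbabilityMeasure (D.sampleLaw π h) :=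
  Measure.isProbabilityMeasure_map (D.measurable_toSample h).aemeasurable

theorem reward_le_one (D : POMDP S O A H) {h : ℕ} (hh : h < H) (o : O) (a : A) :
    D.reward h o a ≤ 1 :=
  (Finset.single_le_sum (f := fun k => D.reward k o a) (fun k _ => D.reward_nonneg k o a)
    (Finset.mem_range.2 hh)).trans (D.reward_sum_le (fun _ => o) (fun _ => a))

theorem integral_step (D : POMDP S O A H) (π : MemPolicy O A M) (h : ℕ) (p : Mem O A M h × S)
    {F : (O × A) × S → ℝ} (hF : Measurable F) {C : ℝ} (hC : ∀ x, |F x| ≤ C) :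
    ∫ x, F x ∂(D.step π h p) = ∫ o, ∫ a, ∫ s, F ((o, a), s) ∂(D.trans h (p.2, a))
      ∂(π.act h (p.1, o)) ∂(D.emit h p.2) := by
  have hi : ∀ μ : Measure ((O × A) × S), IsFiniteMeasure μ → Integrable F μ :=
    fun μ _ => integrable_of_measurable_of_abs_le hF hC
  unfold step
  rw [ProbabilityTheory.integral_compProd (hi _ inferInstance),
    ProbabilityTheory.integral_compProd]
  · simp [Kernel.comap_apply]
  · refine integrable_of_measurable_of_abs_le (C := C) ?_ fun x => ?_
    · exact (hF.stronglyMeasurable.integral_kernel_prod_right'' (η := (D.trans h).comap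
        (fun p : (Mem O A M h × S) × (O × A) => (p.1.2, p.2.2)) (by fun_prop))).measurable
    · exact abs_integral_le_of_abs_le fun y => hC _

/-- The bound is asked only at samples that carry the model's reward: the reward coordinate of
`Sample` is a free real number, in which the loss is unbounded. -/
theorem integral_sampleLaw (D : POMDP S O A H) (π : MemPolicy O A M) (h : ℕ)
    {F : Sample O A M h → ℝ} (hF : Measurable F) {C : ℝ}
    (hC : ∀ z o a o', |F ((z, o), a, D.reward h o a, o')| ≤ C) :
    ∫ ζ, F ζ ∂(D.sampleLaw π h) = ∫ p, ∫ o, ∫ a, ∫ s, ∫ o',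
      F ((p.1, o), a, D.reward h o a, o') ∂(D.emit (h + 1) s) ∂(D.trans h (p.2, a))
        ∂(π.act h (p.1, o)) ∂(D.emit h p.2) ∂(D.stateLaw π h) := by
  have hm : Measurable (fun q : ((Mem O A M h × S) × ((O × A) × S)) × O =>
      F ((q.1.1.1, q.1.2.1.1), q.1.2.1.2, D.reward h q.1.2.1.1 q.1.2.1.2, q.2)) :=
    hF.comp (D.measurable_toSample h)
  have hE : StronglyMeasurable (fun x : (Mem O A M h × S) × ((O × A) × S) =>
      ∫ o', F ((x.1.1, x.2.1.1), x.2.1.2, D.reward h x.2.1.1 x.2.1.2, o')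
        ∂(D.emit (h + 1) x.2.2)) :=
    hm.stronglyMeasurable.integral_kernel_prod_right' (κ := (D.emit (h + 1)).comap
      (fun p : (Mem O A M h × S) × ((O × A) × S) => p.2.2) (by fun_prop))
  unfold sampleLaw
  rw [integral_map (D.measurable_toSample h).aemeasurable hF.aestronglyMeasurable,
    Measure.integral_compProd (integrable_of_measurable_of_abs_le hm fun x => hC _ _ _ _),
    Measure.integral_compProd]
  · refine integral_congr_ae (.of_forall fun p => ?_)
    refine D.integral_step π h p (C := C) ?_ fun x => ?_
    · exact hE.measurable.comp measurable_prodMk_left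
    · exact abs_integral_le_of_abs_le fun y => hC _ _ _ _
  · refine integrable_of_measurable_of_abs_le (C := C) hE.measurable fun x => ?_
    exact abs_integral_le_of_abs_le fun y => hC _ _ _ _

/-- Causality: actions from step `h` on cannot affect the beginning of step `h`. Thus `explore` and
`splice` share the state law of the roll-in policy there. -/
theorem stateLaw_congr (D : POMDP S O A H) {π ρ : MemPolicy O A M} {h : ℕ}
    (hπ : ∀ k < h, π.act k = ρ.act k) : D.stateLaw π h = D.stateLaw ρ h := by
  induction h with
  | zero => rfl
  | succ h ih =>
    have : D.step π h = D.step ρ h := by unfold step; rw [hπ h (by omega)]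
    unfold stateLaw
    rw [ih fun k hk => hπ k (by omega), this]

theorem stateLaw_splice (D : POMDP S O A H) (π ρ : MemPolicy O A M) (h : ℕ) :
    D.stateLaw (π.splice h ρ) h = D.stateLaw π h :=
  D.stateLaw_congr fun k hk => by simp [MemPolicy.splice, hk.ne]

/-- Importance weighting of the uniformly drawn action of step `h`. -/
theorem integral_explore [Fintype A] [Nonempty A] [MeasurableSingletonClass A]
    (D : POMDP S O A H) (π ρ : MemPolicy O A M) (h : ℕ) {F : Sample O A M h → ℝ}
    {G : Mem O A M h × O → ℝ} (hF : Measurable F) (hG : Measurable G) {C : ℝ}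
    (hFC : ∀ z o a o', |F ((z, o), a, D.reward h o a, o')| ≤ C) (hGC : ∀ z, |G z| ≤ C) :
    ∫ ζ, (Fintype.card A * (ρ.act h ζ.1).real {ζ.2.1} * F ζ - G ζ.1) ∂(D.sampleLaw (π.explore h) h)
      = ∫ ζ, (F ζ - G ζ.1) ∂(D.sampleLaw (π.splice h ρ) h) := by
  have hA : (0 : ℝ) < Fintype.card A := by exact_mod_cast Fintype.card_pos
  have hm : Measurable (fun ζ : Sample O A M h => (ρ.act h ζ.1).real {ζ.2.1}) := by
    have : Measurable (fun p : (Mem O A M h × O) × A => (ρ.act h p.1).real {p.2}) :=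
      measurable_from_prod_countable_left fun a =>
        ((ρ.act h).measurable_coe (measurableSet_singleton a)).ennreal_toReal
    exact this.comp (measurable_fst.prodMk (measurable_fst.comp measurable_snd))
  have hρ : ∀ z a, |(ρ.act h z).real {a}| ≤ 1 := fun z a => by
    rw [abs_of_nonneg measureReal_nonneg]; exact measureReal_le_one
  have hI (z : Mem O A M h) (s : S) (o : O) (a : A) (c e : ℝ) :
      ∫ s', ∫ o', (c * F ((z, o), a, D.reward h o a, o') - e) ∂(D.emit (h + 1) s')
          ∂(D.trans h (s, a))
        = c * (∫ s', ∫ o', F ((z, o), a, D.reward h o a, o') ∂(D.emit (h + 1) s')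
          ∂(D.trans h (s, a))) - e := by
    have hm' : Measurable fun o' => F ((z, o), a, D.reward h o a, o') := by fun_prop
    have h1 : ∀ s', ∫ o', (c * F ((z, o), a, D.reward h o a, o') - e) ∂(D.emit (h + 1) s')
        = c * ∫ o', F ((z, o), a, D.reward h o a, o') ∂(D.emit (h + 1) s') - e := fun s' => by
      rw [integral_sub ((integrable_of_measurable_of_abs_le hm' fun _ => hFC _ _ _ _).const_mul _)
        (integrable_const _), integral_const_mul]
      simp
    simp_rw [h1]
    rw [integral_sub (Integrable.const_mul (integrable_of_measurable_of_abs_le (C := C)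
      (hm'.stronglyMeasurable.integral_kernel).measurable
        fun _ => abs_integral_le_of_abs_le fun _ => hFC _ _ _ _) _)
        (integrable_const _), integral_const_mul]
    simp
  have hC0 : ∀ z : Mem O A M h, ∀ o : O, 0 ≤ C := fun z o => (abs_nonneg _).trans (hGC (z, o))
  rw [D.integral_sampleLaw (F := fun ζ : Sample O A M h =>
      Fintype.card A * (ρ.act h ζ.1).real {ζ.2.1} * F ζ - G ζ.1) (C := Fintype.card A * 1 * C + C),
    D.integral_sampleLaw (F := fun ζ : Sample O A M h => F ζ - G ζ.1) (C := C + C)]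
  · unfold MemPolicy.explore
    rw [stateLaw_splice, stateLaw_splice]
    refine integral_congr_ae (.of_forall fun p => integral_congr_ae (.of_forall fun o => ?_))
    -- The spliced side is the same affine identity with importance weight `1`.
    have h2 := fun a => hI p.1 p.2 o a 1 (G (p.1, o))
    simp only [one_mul] at h2
    simp only [MemPolicy.splice, if_true, hI, h2]
    rw [integral_fintype (.of_finite), integral_fintype (.of_finite)]
    simp only [smul_eq_mul, mul_sub, Finset.sum_sub_distrib, ← Finset.sum_mul]
    -- The mass `1/|A|` of a uniform action cancels the factor `|A|`. The `G` term does not involve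
    -- the action, so on both sides it only meets total mass one.
    have hu : ∀ a, ((MemPolicy.unif O A M).act h (p.1, o)).real {a} = 1 / Fintype.card A := by
      intro a
      change ((PMF.uniformOfFintype A).toMeasure {a}).toReal = _
      rw [PMF.toMeasure_apply_singleton _ _ (measurableSet_singleton a)]
      simp
    have hs : ∀ μ : Measure A, IsProbabilityMeasure μ → ∑ a, μ.real {a} = 1 := by
      intro μ _
      simp
    rw [hs _ inferInstance, hs _ inferInstance]
    congr 1
    refine Finset.sum_congr rfl fun a _ => ?_
    rw [hu]
    field_simp
  · exact hF.sub (hG.comp measurable_fst)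
  · intro z o a o'
    exact (abs_sub _ _).trans (add_le_add (hFC _ _ _ _) (hGC _))
  · exact ((measurable_const.mul hm).mul hF).sub (hG.comp measurable_fst)
  · intro z o a o'
    refine (abs_sub _ _).trans (add_le_add ?_ (hGC _))
    rw [abs_mul, abs_mul, abs_of_pos hA]
    have := hC0 z o
    gcongr
    exacts [hρ _ _, hFC _ _ _ _]

end POMDP

/-! ### Values, values to go and value link functions -/

namespace POMDP

variable {S : Type w} {O : Type u} {A : Type v} [MeasurableSpace S] [MeasurableSpace O]
  [MeasurableSpace A] {H M : ℕ}

theorem abs_reward_le_one (D : POMDP S O A H) {h : ℕ} (hh : h < H) (o : O) (a : A) :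
    |D.reward h o a| ≤ 1 := by
  rw [abs_of_nonneg (D.reward_nonneg h o a)]; exact D.reward_le_one hh o a

theorem measurable_valueToGo_step (D : POMDP S O A H) {h : ℕ} {F : Mem O A M (h + 1) × S → ℝ}
    (hF : Measurable F) : Measurable (fun q : (Mem O A M h × S) × ((O × A) × S) =>
      D.reward h q.2.1.1 q.2.1.2 + F (q.1.1.push q.2.1, q.2.2)) :=
  ((D.reward_meas h).comp (f := fun q : (Mem O A M h × S) × ((O × A) × S) => q.2.1)
    (by fun_prop)).add (hF.comp measurable_push_step)

theorem measurable_valueToGo (D : POMDP S O A H) (π : MemPolicy O A M) (n : ℕ) :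
    ∀ h, Measurable (D.valueToGo π n h) := by
  induction n with
  | zero => intro h; exact measurable_const
  | succ n ih =>
    intro h
    exact (D.measurable_valueToGo_step (ih (h + 1))).stronglyMeasurable.integral_kernel_prod_right'
      (κ := D.step π h) |>.measurable

theorem abs_valueToGo_le (D : POMDP S O A H) (π : MemPolicy O A M) (n : ℕ) :
    ∀ h, h + n ≤ H → ∀ p, |D.valueToGo π n h p| ≤ n := by
  induction n with
  | zero => intro h _ p; simp [valueToGo]
  | succ n ih =>
    intro h hh p
    refine abs_integral_le_of_abs_le fun x => (abs_add_le _ _).trans ?_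
    push_cast
    linarith [D.abs_reward_le_one (show h < H by omega) x.1.1 x.1.2,
      ih (h + 1) (by omega) (p.1.push x.1, x.2)]

theorem integral_reward_sampleLaw (D : POMDP S O A H) (π : MemPolicy O A M) (h : ℕ) :
    ∫ ζ, ζ.2.2.1 ∂(D.sampleLaw π h)
      = ∫ q, D.reward h q.2.1.1 q.2.1.2 ∂(D.stateLaw π h ⊗ₘ D.step π h) := by
  have hm : Measurable (fun q : (Mem O A M h × S) × ((O × A) × S) =>
      D.reward h q.2.1.1 q.2.1.2) :=
    (D.reward_meas h).comp (f := fun q : (Mem O A M h × S) × ((O × A) × S) => q.2.1) (by fun_prop)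
  unfold sampleLaw
  rw [integral_map (D.measurable_toSample h).aemeasurable
    (by fun_prop : Measurable fun ζ : Sample O A M h => ζ.2.2.1).aestronglyMeasurable]
  set ν := D.stateLaw π h ⊗ₘ D.step π h
  conv_rhs => rw [← Measure.fst_compProd ν ((D.emit (h + 1)).comap
    (fun p : (Mem O A M h × S) × ((O × A) × S) => p.2.2) (by fun_prop)), Measure.fst]
  rw [integral_map measurable_fst.aemeasurable hm.aestronglyMeasurable]

/-- Averaging the recursion over the state law splits off the reward of step `h`; the remainder is
an integral against the pushed-forward law, which is the state law of step `h + 1`. -/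
theorem integral_valueToGo (D : POMDP S O A H) (π : MemPolicy O A M) (n : ℕ) :
    ∀ h, h + n ≤ H → ∫ p, D.valueToGo π n h p ∂(D.stateLaw π h)
      = ∑ k ∈ Finset.range n, ∫ ζ, ζ.2.2.1 ∂(D.sampleLaw π (h + k)) := by
  induction n with
  | zero => intro h _; simp [valueToGo]
  | succ n ih =>
    intro h hh
    have hm := D.measurable_valueToGo π n (h + 1)
    have hb : ∀ p, |D.valueToGo π n (h + 1) p| ≤ n := D.abs_valueToGo_le π n (h + 1) (by omega)
    have hr : ∀ q : (Mem O A M h × S) × ((O × A) × S), |D.reward h q.2.1.1 q.2.1.2| ≤ 1 :=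
      fun q => D.abs_reward_le_one (by omega) _ _
    have hrm : Measurable (fun q : (Mem O A M h × S) × ((O × A) × S) =>
        D.reward h q.2.1.1 q.2.1.2) :=
      (D.reward_meas h).comp (f := fun q : (Mem O A M h × S) × ((O × A) × S) => q.2.1)
        (by fun_prop)
    have h1 : ∫ p, D.valueToGo π (n + 1) h p ∂(D.stateLaw π h)
        = ∫ q, (D.reward h q.2.1.1 q.2.1.2
          + D.valueToGo π n (h + 1) (q.1.1.push q.2.1, q.2.2))
            ∂(D.stateLaw π h ⊗ₘ D.step π h) := by
      rw [Measure.integral_compProd]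
      · rfl
      · exact integrable_of_measurable_of_abs_le (C := 1 + n) (D.measurable_valueToGo_step hm)
          fun q => (abs_add_le _ _).trans (add_le_add (hr q) (hb _))
    rw [h1, integral_add (integrable_of_measurable_of_abs_le hrm hr)
      (integrable_of_measurable_of_abs_le (f := fun q : (Mem O A M h × S) × ((O × A) × S) =>
        D.valueToGo π n (h + 1) (q.1.1.push q.2.1, q.2.2)) (hm.comp measurable_push_step)
        fun q => hb _),
      ← integral_reward_sampleLaw, Finset.sum_range_succ']
    have h2 := ih (h + 1) (by omega)
    unfold stateLaw at h2
    rw [integral_map measurable_push_step.aemeasurable hm.aestronglyMeasurable] at h2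
    let r : ℕ → ℝ := fun k => ∫ ζ, ζ.2.2.1 ∂(D.sampleLaw π k)
    rw [h2, add_comm]
    change ∑ k ∈ Finset.range n, r (h + 1 + k) + r h
      = ∑ k ∈ Finset.range n, r (h + (k + 1)) + r (h + 0)
    simp only [add_zero, add_assoc, add_comm 1]

/-- A bounded value link function of `π` predicts the value of `π`. -/
theorem IsValueLink.integral_eq_value {D : POMDP S O A H} {π : MemPolicy O A M}
    {g : LinkFn O A M H} (hg : D.IsValueLink π g) (hH : 0 < H) {B : ℝ}
    (hB : ∀ h z, |g.val h z| ≤ B) :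
    ∫ o, g.val 0 (Mem.empty, o) ∂(D.init.bind (D.emit 0)) = D.value π := by
  have hgm : Measurable fun o => g.val 0 (Mem.empty, o) :=
    (g.meas 0).comp measurable_prodMk_left
  rw [← Measure.snd_compProd, Measure.snd, integral_map measurable_snd.aemeasurable
    hgm.aestronglyMeasurable, Measure.integral_compProd
    (integrable_of_measurable_of_abs_le (f := fun x : S × O => g.val 0 (Mem.empty, x.2))
      (hgm.comp measurable_snd) fun x => hB _ _)]
  let r : ℕ → ℝ := fun k => ∫ ζ, ζ.2.2.1 ∂(D.sampleLaw π k)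
  have h1 : ∫ p, D.valueToGo π H 0 p ∂(D.stateLaw π 0) = ∑ k ∈ Finset.range H, r k :=
    (D.integral_valueToGo π H 0 (by omega)).trans
      (Finset.sum_congr rfl fun k _ => congrArg r (zero_add k))
  change _ = ∑ k ∈ Finset.range H, r k
  rw [← h1, stateLaw, Measure.dirac_prod, integral_map (by fun_prop)
    (D.measurable_valueToGo π H 0).aestronglyMeasurable]
  exact integral_congr_ae (.of_forall fun s => hg 0 hH Mem.empty s)

end POMDP

/-! ### The loss, its mean, and the optimal hypothesis -/

section Loss

variable {S : Type w} {O : Type u} {A : Type v} [MeasurableSpace S] [MeasurableSpace O]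
  [MeasurableSpace A] [Fintype A] {H M N : ℕ} {Pol : Finset (MemPolicy O A M)}
  {𝒢 : Finset (LinkFn O A M H)}

/-- An almost sure bound for the loss when the link functions are bounded by `B`. -/
def lossBound (A : Type v) [Fintype A] (B : ℝ) : ℝ := Fintype.card A * (1 + B) + B

theorem abs_loss_le {B : ℝ} (hB : ∀ g ∈ 𝒢, ∀ h z, |g.val h z| ≤ B) {h : ℕ} (f : Hyp Pol 𝒢)
    (ζ : Sample O A M h) (hζ : |ζ.2.2.1| ≤ 1) : |loss f ζ| ≤ lossBound A B := by
  have hg : ∀ k z, |f.link.val k z| ≤ B := hB _ f.2.2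
  have h1 : |(f.pol.act h ζ.1).real {ζ.2.1}| ≤ 1 := by
    rw [abs_of_nonneg measureReal_nonneg]; exact measureReal_le_one
  unfold loss lossBound
  refine (abs_sub _ _).trans (add_le_add ?_ (hg _ _))
  rw [abs_mul, abs_mul, Nat.abs_cast]
  calc _ ≤ (Fintype.card A : ℝ) * 1 * (1 + B) := by
        gcongr
        exact (abs_add_le _ _).trans (add_le_add hζ (hg _ _))
    _ = _ := by ring

omit [Fintype A] in
theorem ae_abs_reward_sampleLaw_le (D : POMDP S O A H) (π : MemPolicy O A M) {h : ℕ} (hh : h < H) :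
    ∀ᵐ ζ ∂(D.sampleLaw π h), |ζ.2.2.1| ≤ 1 := by
  unfold POMDP.sampleLaw
  rw [ae_map_iff (D.measurable_toSample h).aemeasurable
    (measurableSet_le (by fun_prop) measurable_const)]
  exact .of_forall fun q => D.abs_reward_le_one hh _ _

variable [Nonempty A] [MeasurableSingletonClass A]

/-- The loss of a hypothesis under an exploration policy has mean the Bellman error. -/
theorem integral_loss_explore (D : POMDP S O A H) {B : ℝ} (hB : ∀ g ∈ 𝒢, ∀ h z, |g.val h z| ≤ B)
    (f : Hyp Pol 𝒢) (π : MemPolicy O A M) {h : ℕ} (hh : h < H) :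
    ∫ ζ, loss f ζ ∂(D.sampleLaw (π.explore h) h) =
      ∫ ζ, (ζ.2.2.1 + f.link.val (h + 1) ζ.next - f.link.val h ζ.1)
        ∂(D.sampleLaw (π.splice h f.pol) h) := by
  have hg : ∀ k z, |f.link.val k z| ≤ B := hB _ f.2.2
  have h2 : Measurable (fun ζ : Sample O A M h => ζ.next) := by
    refine Measurable.prodMk ?_ (by fun_prop)
    exact measurable_push.comp (f := fun ζ : Sample O A M h => (ζ.1.1, (ζ.1.2, ζ.2.1)))
      (by fun_prop)
  exact D.integral_explore π f.pol h (F := fun ζ => ζ.2.2.1 + f.link.val (h + 1) ζ.next)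
    (G := f.link.val h) (C := 1 + B)
    (Measurable.add (by fun_prop) ((f.link.meas (h + 1)).comp h2)) (f.link.meas h)
    (fun z o a o' => (abs_add_le _ _).trans (add_le_add (D.abs_reward_le_one hh _ _) (hg _ _)))
    (fun z => (hg _ _).trans (by linarith))

/-- In the PO-bilinear class, some hypothesis predicts the optimal value and has vanishing
expected loss under all exploration policies. -/
theorem exists_optimal_hyp {V : Type x} [NormedAddCommGroup V] [InnerProductSpace ℝ V]
    [CompleteSpace V] (D : POMDP S O A H) {B : ℝ} (hH : 0 < H)
    (hB : ∀ g ∈ 𝒢, ∀ h z, |g.val h z| ≤ B) (hne : Pol.Nonempty) (hD : D.IsPOBilinear Pol 𝒢 V) :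
    ∃ f : Hyp Pol 𝒢, f.predValue D = optValue D Pol ∧ ∀ (f' : Hyp Pol 𝒢) (h : Fin H),
      ∫ ζ, loss f ζ ∂(D.sampleLaw (f'.pol.explore h) h) = 0 := by
  obtain ⟨W, X, gπ, h1, h2, h3⟩ := hD
  have : Nonempty Pol := hne.to_subtype
  obtain ⟨π, hπ⟩ := exists_eq_ciSup_of_finite (f := fun π : Pol => D.value π.1)
  let f : Hyp Pol 𝒢 := (π, ⟨gπ π, (h1 π π.2).1⟩)
  refine ⟨f, ?_, fun f' h => ?_⟩
  · rw [optValue, ← hπ]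
    exact (h1 π π.2).2.integral_eq_value hH (hB _ (h1 π π.2).1)
  · rw [integral_loss_explore D hB _ _ h.2]
    refine (h2 π π.2 _ f'.1.2 _ (h1 π π.2).1 h).trans ?_
    rw [h3 π π.2 h, inner_zero_left]

end Loss

/-! ### Concentration of empirical means -/

/-- Above the threshold `a`, combine `z² ≤ 2a² + 2(z - a)²` with `(z - a)²/2 ≤ exp (z - a)`. This
bounds a maximum of squares by moment generating functions, without integrating tails. -/
theorem sq_le_two_mul_sq_add_exp {a z : ℝ} (hz : 0 ≤ z) (ha : 0 ≤ a) :
    z ^ 2 ≤ 2 * a ^ 2 + 4 * Real.exp (z - a) := by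
  rcases le_total z a with h | h
  · nlinarith [Real.exp_pos (z - a)]
  · nlinarith [Real.quadratic_le_exp_of_nonneg (sub_nonneg.2 h), sq_nonneg (z - 2 * a)]

section Concentration

variable {α : Type*} [MeasurableSpace α] {P : Measure α} [IsProbabilityMeasure P] {N : ℕ} {b : ℝ}

/-- Hoeffding's lemma on `[-b, b]` has variance proxy `b²`; independence turns the average into `N`
factors taken at `t / N`. -/
theorem integral_exp_mul_average_le (hN : 0 < N) {X : α → ℝ} (hX : Measurable X) (hb : 0 < b)
    (hXb : ∀ᵐ x ∂P, |X x| ≤ b) (t : ℝ) :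
    Integrable (fun x : Fin N → α => Real.exp (t * ((1 / (N : ℝ)) * ∑ i, X (x i) - ∫ y, X y ∂P)))
        (Measure.pi fun _ => P) ∧
      ∫ x : Fin N → α, Real.exp (t * ((1 / (N : ℝ)) * ∑ i, X (x i) - ∫ y, X y ∂P))
        ∂(Measure.pi fun _ => P) ≤ Real.exp (b ^ 2 * t ^ 2 / (2 * N)) := by
  have hN' : (0 : ℝ) < N := by exact_mod_cast hN
  set m := ∫ y, X y ∂P
  have hs := hasSubgaussianMGF_of_mem_Icc (a := -b) (b := b) hX.aemeasurable
    (hXb.mono fun x hx => abs_le.1 hx)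
  have he : (fun x : Fin N → α => Real.exp (t * ((1 / (N : ℝ)) * ∑ i, X (x i) - m)))
      = fun x => ∏ i, Real.exp (t / N * (X (x i) - m)) := by
    funext x
    rw [← Real.exp_sum, ← Finset.mul_sum, Finset.sum_sub_distrib]
    congr 1
    simp
    field_simp
  rw [he]
  refine ⟨Integrable.fintype_prod fun _ => hs.integrable_exp_mul _, ?_⟩
  rw [integral_fintype_prod_eq_pow (fun y => Real.exp (t / N * (X y - m))), Fintype.card_fin]
  have h1 := hs.mgf_le (t / N)
  have h2 : ((((‖b - -b‖₊ / 2) ^ 2 : NNReal)) : ℝ) = b ^ 2 := by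
    push_cast
    rw [Real.norm_eq_abs, div_pow, sq_abs]; ring
  rw [h2] at h1
  refine (pow_le_pow_left₀ mgf_nonneg h1 N).trans_eq ?_
  rw [← Real.exp_nat_mul]
  congr 1
  field_simp

/-- Maximal inequality for the squared deviations of finitely many empirical means. -/
theorem integral_iSup_sq_average_le {ι : Type*} [Fintype ι] [Nonempty ι] (hN : 0 < N)
    {X : ι → α → ℝ} (hX : ∀ f, Measurable (X f)) (hb : 0 < b)
    (hXb : ∀ f, ∀ᵐ x ∂P, |X f x| ≤ b) :
    ∫ x : Fin N → α, ⨆ f, ((1 / (N : ℝ)) * ∑ i, X f (x i) - ∫ y, X f y ∂P) ^ 2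
        ∂(Measure.pi fun _ => P)
      ≤ 8 * b ^ 2 * (1 + Real.log (Fintype.card ι)) / N := by
  have hN' : (0 : ℝ) < N := by exact_mod_cast hN
  have hn : (1 : ℝ) ≤ Fintype.card ι := by exact_mod_cast Fintype.card_pos
  set n : ℝ := (Fintype.card ι : ℝ)
  set L := 1 + Real.log n with hL
  have hlog : 0 ≤ Real.log n := Real.log_nonneg hn
  have hL1 : 1 ≤ L := by linarith
  set Y : ι → (Fin N → α) → ℝ := fun f x => (1 / (N : ℝ)) * ∑ i, X f (x i) - ∫ y, X f y ∂P
  -- This `t` solves `b² t² / (2N) = L`, so each moment generating function is at most `exp L`.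
  set t := Real.sqrt (2 * L * N / b ^ 2) with ht
  have ht2 : t ^ 2 = 2 * L * N / b ^ 2 := Real.sq_sqrt (by positivity)
  have ht0 : 0 ≤ t := Real.sqrt_nonneg _
  have htp : 0 < t ^ 2 := by rw [ht2]; positivity
  -- The threshold `2L` pays for `exp L` and for the union over `n` indices: `exp (-2L) · n · exp L
  -- = exp (-1)`.
  obtain ⟨a, ha⟩ : ∃ a, a = 2 * L := ⟨_, rfl⟩
  have ha0 : 0 ≤ a := by linarith
  have hmgf := fun f s => integral_exp_mul_average_le (P := P) hN (hX f) hb (hXb f) s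
  have hbound : ∀ x, ⨆ f, (Y f x) ^ 2 ≤ (t ^ 2)⁻¹ * (2 * a ^ 2 + 4 * (Real.exp (-a) *
      ∑ f, (Real.exp (t * Y f x) + Real.exp (-t * Y f x)))) := by
    intro x
    refine ciSup_le fun f => ?_
    rw [inv_mul_eq_div, le_div_iff₀ htp]
    have h1 := sq_le_two_mul_sq_add_exp (z := t * |Y f x|) (a := a) (by positivity) ha0
    have h2 : Real.exp (t * |Y f x|) ≤ Real.exp (t * Y f x) + Real.exp (-t * Y f x) := by
      rcases abs_cases (Y f x) with ⟨h, -⟩ | ⟨h, -⟩ <;> rw [h]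
      · linarith [Real.exp_pos (-t * Y f x)]
      · rw [mul_neg, ← neg_mul]; linarith [Real.exp_pos (t * Y f x)]
    have h3 := Finset.single_le_sum (f := fun f => Real.exp (t * Y f x) + Real.exp (-t * Y f x))
      (fun f _ => by positivity) (Finset.mem_univ f)
    rw [sub_eq_neg_add, Real.exp_add] at h1
    have h4 := mul_le_mul_of_nonneg_left (h2.trans h3) (Real.exp_pos (-a)).le
    rw [mul_pow, sq_abs] at h1
    linarith
  have hI : ∀ f, Integrable (fun x => Real.exp (t * Y f x) + Real.exp (-t * Y f x))
      (Measure.pi fun _ => P) := fun f => (hmgf f t).1.add (hmgf f (-t)).1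
  have hS : Integrable (fun x => 4 * (Real.exp (-a) *
      ∑ f, (Real.exp (t * Y f x) + Real.exp (-t * Y f x)))) (Measure.pi fun _ => P) :=
    ((integrable_finsetSum _ fun f _ => hI f).const_mul _).const_mul _
  refine (integral_mono_of_nonneg (.of_forall fun x => Real.iSup_nonneg fun f => sq_nonneg _)
    (((integrable_const _).add hS).const_mul _) (.of_forall hbound)).trans ?_
  rw [integral_const_mul, Pi.add_def, integral_add (integrable_const _) hS, integral_const, integral_const_mul,
    integral_const_mul, integral_finsetSum _ fun f _ => hI f]
  have hsum : ∑ f, ∫ x, (Real.exp (t * Y f x) + Real.exp (-t * Y f x)) ∂(Measure.pi fun _ => P)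
      ≤ n * (2 * Real.exp L) := by
    have : ∀ f ∈ (Finset.univ : Finset ι), ∫ x, (Real.exp (t * Y f x) + Real.exp (-t * Y f x))
        ∂(Measure.pi fun _ => P) ≤ 2 * Real.exp L := by
      intro f _
      rw [integral_add (hmgf f t).1 (hmgf f (-t)).1, two_mul]
      have e : b ^ 2 * t ^ 2 / (2 * N) = L := by rw [ht2]; field_simp
      have h1 := (hmgf f t).2
      have h2 := (hmgf f (-t)).2
      rw [neg_sq] at h2
      rw [e] at h1 h2
      exact add_le_add h1 h2
    simpa [n] using Finset.sum_le_sum this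
  have hexp : Real.exp (-a) * (n * (2 * Real.exp L)) ≤ 2 := by
    have h1 : n = Real.exp (Real.log n) := (Real.exp_log (by linarith)).symm
    have h2 : Real.exp (-a) * (n * (2 * Real.exp L)) = 2 * Real.exp (-1) := by
      rw [show Real.exp (-a) * (n * (2 * Real.exp L)) = 2 * (Real.exp (-a) * n * Real.exp L) by ring]
      nth_rewrite 1 [h1]
      rw [← Real.exp_add, ← Real.exp_add]
      congr 2
      rw [ha, hL]; ring
    rw [h2]
    linarith [Real.exp_le_one_iff.2 (show (-1 : ℝ) ≤ 0 by norm_num)]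
  have hfin := (mul_le_mul_of_nonneg_left hsum (Real.exp_pos (-a)).le).trans hexp
  simp only [probReal_univ, one_smul]
  -- The bracket is at most `8 L² + 8`, and `L ≥ 1`.
  calc _ ≤ (t ^ 2)⁻¹ * (16 * L ^ 2) := by
        gcongr
        have : a ^ 2 = 4 * L ^ 2 := by rw [ha]; ring
        nlinarith
    _ = _ := by rw [ht2]; field_simp; ring

end Concentration

/-- Gibbs variational inequality for a finite uniform prior. -/
theorem sum_gibbs_mul_le {ι : Type*} [Fintype ι] (E : ι → ℝ) (f₀ : ι) :
    ∑ f, Real.exp (-E f) / (∑ f', Real.exp (-E f')) * E f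
      ≤ E f₀ + Real.log (Fintype.card ι) := by
  have : Nonempty ι := ⟨f₀⟩
  have hn : (0 : ℝ) < Fintype.card ι := by exact_mod_cast Fintype.card_pos
  set n : ℝ := (Fintype.card ι : ℝ) with hndef
  set Z := ∑ f', Real.exp (-E f') with hZ
  have hZ0 : Real.exp (-E f₀) ≤ Z :=
    Finset.single_le_sum (f := fun f => Real.exp (-E f)) (fun f _ => (Real.exp_pos _).le)
      (Finset.mem_univ f₀)
  have hZp : 0 < Z := (Real.exp_pos _).trans_le hZ0
  set c := E f₀ + Real.log n with hc
  have hterm : ∀ f ∈ (Finset.univ : Finset ι), Real.exp (-E f) / Z * E f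
      ≤ Real.exp (-E f₀) / (n * Z) + Real.exp (-E f) / Z * (c - 1) := by
    intro f _
    have h1 := Real.add_one_le_exp (E f - c)
    -- The Gibbs weight times `exp (E f - c)` does not depend on `f`; summed over the `n` indices it
    -- gives `exp (-E f₀) / Z ≤ 1`.
    have h2 : Real.exp (-E f) / Z * Real.exp (E f - c) = Real.exp (-E f₀) / (n * Z) := by
      rw [div_mul_eq_mul_div, ← Real.exp_add, hc,
        show -E f + (E f - (E f₀ + Real.log n)) = -E f₀ - Real.log n by ring, Real.exp_sub,
        Real.exp_log hn, div_div]
    rw [← h2, ← mul_add]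
    gcongr
    linarith
  refine (Finset.sum_le_sum hterm).trans ?_
  have hp : ∑ f, Real.exp (-E f) / Z = 1 := by rw [← Finset.sum_div, ← hZ, div_self hZp.ne']
  rw [Finset.sum_add_distrib, ← Finset.sum_mul, hp,
    Finset.sum_const, Finset.card_univ, nsmul_eq_mul, ← hndef, one_mul]
  have : n * (Real.exp (-E f₀) / (n * Z)) ≤ 1 := by
    rw [← mul_div_assoc, mul_div_mul_left _ _ hn.ne']
    exact (div_le_one hZp).2 hZ0
  linarith

/-! ### Quantities along a run, and the posterior as a Gibbs measure -/

section Run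

variable {S : Type w} {O : Type u} {A : Type v} [MeasurableSpace S] [MeasurableSpace O]
  [MeasurableSpace A] [Fintype A] {H M N : ℕ} {Pol : Finset (MemPolicy O A M)}
  {𝒢 : Finset (LinkFn O A M H)}

/-- The empirical mean of the loss of `f` on the samples of step `h` of a batch. -/
def avgLoss (f : Hyp Pol 𝒢) (b : Batch O A M H N) (h : Fin H) : ℝ :=
  (1 / (N : ℝ)) * ∑ i : Fin N, loss f (b h i)

/-- The mean of the loss of `f` on samples of step `h` that are collected with `f'`. -/
def meanLoss [Nonempty A] (D : POMDP S O A H) (f' f : Hyp Pol 𝒢) (h : Fin H) : ℝ :=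
  ∫ ζ, loss f ζ ∂(D.sampleLaw (f'.pol.explore h) h)

/-- The largest squared deviations of the empirical means from the means, summed over the steps. -/
def deviation [Nonempty A] (D : POMDP S O A H) (x : Hyp Pol 𝒢 × Batch O A M H N) : ℝ :=
  ∑ h, ⨆ f, (avgLoss f x.2 h - meanLoss D x.1 f h) ^ 2

/-- The cumulative squared empirical loss of `f`. -/
def cumLoss {t : ℕ} (ω : Run Pol 𝒢 N t) (f : Hyp Pol 𝒢) : ℝ :=
  ∑ h, ∑ s, avgLoss f (ω s).2 h ^ 2

/-- The sum of the gaps between the optimal and the predicted values, penalised by the squared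
empirical losses of the drawn hypotheses on the earlier batches. -/
def potential (D : POMDP S O A H) {t : ℕ} (ω : Run Pol 𝒢 N t) : ℝ :=
  ∑ j, (optValue D Pol - (ω j).1.predValue D
    + ∑ h, ∑ s ∈ Finset.Iio j, avgLoss (ω j).1 (ω s).2 h ^ 2)

theorem potential_snoc (D : POMDP S O A H) {t : ℕ} (ω : Run Pol 𝒢 N t)
    (x : Hyp Pol 𝒢 × Batch O A M H N) :
    potential D (Fin.snoc ω x : Run Pol 𝒢 N (t + 1))
      = potential D ω + (optValue D Pol - x.1.predValue D + cumLoss ω x.1) := by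
  have hlast : Finset.Iio (Fin.last t) = Finset.univ.map Fin.castSuccEmb := by
    ext i
    induction i using Fin.lastCases with
    | last => simp [Fin.castSucc_ne_last]
    | cast i => simp
  unfold potential cumLoss
  rw [Fin.sum_univ_castSucc]
  simp only [Fin.snoc_castSucc, Fin.snoc_last, ← Fin.map_castSuccEmb_Iio, hlast,
    Finset.sum_map, Fin.coe_castSuccEmb]

theorem deviation_nonneg [Nonempty A] (D : POMDP S O A H) (x : Hyp Pol 𝒢 × Batch O A M H N) :
    0 ≤ deviation D x :=
  Finset.sum_nonneg fun _ _ => Real.iSup_nonneg fun _ => sq_nonneg _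

theorem sq_sub_le_iSup [Nonempty A] (D : POMDP S O A H) (x : Hyp Pol 𝒢 × Batch O A M H N)
    (f : Hyp Pol 𝒢) (h : Fin H) : (avgLoss f x.2 h - meanLoss D x.1 f h) ^ 2
      ≤ ⨆ f, (avgLoss f x.2 h - meanLoss D x.1 f h) ^ 2 :=
  le_ciSup (f := fun f => (avgLoss f x.2 h - meanLoss D x.1 f h) ^ 2)
    (Set.finite_range _).bddAbove f

/-- When all means vanish, each squared empirical mean is itself a squared deviation, hence below
the supremum. -/
theorem cumLoss_le_sum_deviation [Nonempty A] (D : POMDP S O A H) {t : ℕ} (ω : Run Pol 𝒢 N t)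
    {f : Hyp Pol 𝒢} (hf : ∀ f' h, meanLoss D f' f h = 0) :
    cumLoss ω f ≤ ∑ s, deviation D (ω s) := by
  unfold cumLoss deviation
  rw [Finset.sum_comm]
  refine Finset.sum_le_sum fun s _ => Finset.sum_le_sum fun h _ => ?_
  simpa [hf] using sq_sub_le_iSup D (ω s) f h

/-- A batch all of whose rewards are in the range of the rewards of the model. -/
def Regular (b : Batch O A M H N) : Prop := ∀ h i, |(b h i).2.2.1| ≤ 1

omit [Fintype A] in
theorem measurableSet_regular : MeasurableSet {b : Batch O A M H N | Regular b} := by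
  simp only [Regular, Set.ofPred_forall]
  exact .iInter fun h => .iInter fun i => measurableSet_le (by fun_prop) measurable_const

section Bounds

variable {B : ℝ} (hB0 : 0 < B) (hB : ∀ g ∈ 𝒢, ∀ h z, |g.val h z| ≤ B)

include hB0 in
omit [MeasurableSpace A] in
theorem lossBound_pos [Nonempty A] : 0 < lossBound A B := by
  unfold lossBound; positivity

include hB0 hB in
theorem abs_avgLoss_le [Nonempty A] (f : Hyp Pol 𝒢) {b : Batch O A M H N} (hb : Regular b)
    (h : Fin H) : |avgLoss f b h| ≤ lossBound A B := by
  have hL : 0 < lossBound A B := lossBound_pos hB0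
  unfold avgLoss
  rcases Nat.eq_zero_or_pos N with rfl | hN
  · simpa using hL.le
  have hN' : (0 : ℝ) < N := by exact_mod_cast hN
  rw [abs_mul, abs_of_pos (by positivity : 0 < 1 / (N : ℝ)), one_div_mul_eq_div, div_le_iff₀ hN']
  refine (Finset.abs_sum_le_sum_abs _ _).trans
    ((Finset.sum_le_sum fun i _ => abs_loss_le hB f (b h i) (hb h i)).trans_eq ?_)
  simp [mul_comm]

include hB in
theorem abs_meanLoss_le [Nonempty A] (D : POMDP S O A H) (f' f : Hyp Pol 𝒢) (h : Fin H) :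
    |meanLoss D f' f h| ≤ lossBound A B := by
  have := norm_integral_le_of_norm_le_const (μ := D.sampleLaw (f'.pol.explore h) h)
    (f := loss f) (C := lossBound A B) ((ae_abs_reward_sampleLaw_le D (f'.pol.explore h) h.2).mono
      fun ζ hζ => abs_loss_le hB f ζ hζ)
  simpa [meanLoss] using this

include hB0 hB in
theorem deviation_le [Nonempty A] (D : POMDP S O A H) (x : Hyp Pol 𝒢 × Batch O A M H N)
    (hx : Regular x.2) : deviation D x ≤ H * (2 * lossBound A B) ^ 2 := by
  have : Nonempty (Hyp Pol 𝒢) := ⟨x.1⟩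
  have : ∀ h ∈ (Finset.univ : Finset (Fin H)),
      ⨆ f, (avgLoss f x.2 h - meanLoss D x.1 f h) ^ 2 ≤ (2 * lossBound A B) ^ 2 := by
    refine fun h _ => ciSup_le fun f => sq_le_sq' ?_ ?_
    all_goals
      have h1 := abs_le.1 (abs_avgLoss_le hB0 hB f hx h)
      have h2 := abs_le.1 (abs_meanLoss_le hB D x.1 f h)
      linarith
  simpa [deviation] using Finset.sum_le_sum this

include hB0 hB in
theorem avgLoss_sq_le [Nonempty A] (f : Hyp Pol 𝒢) {b : Batch O A M H N} (hb : Regular b)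
    (h : Fin H) : avgLoss f b h ^ 2 ≤ lossBound A B ^ 2 :=
  sq_le_sq.2 ((abs_avgLoss_le hB0 hB f hb h).trans (le_abs_self _))

end Bounds

variable [MeasurableSingletonClass A]

theorem measurable_avgLoss (f : Hyp Pol 𝒢) (h : Fin H) :
    Measurable (fun b : Batch O A M H N => avgLoss f b h) :=
  measurable_const.mul (Finset.measurable_sum _ fun i _ => (measurable_loss f).comp (by fun_prop))

theorem measurable_avgLoss_uncurry (h : Fin H) : Measurable
    (fun p : Hyp Pol 𝒢 × Batch O A M H N => avgLoss p.1 p.2 h) :=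
  measurable_from_prod_countable_right fun f => measurable_avgLoss f h

theorem measurable_deviation [Nonempty A] (D : POMDP S O A H) :
    Measurable (deviation D : Hyp Pol 𝒢 × Batch O A M H N → ℝ) :=
  measurable_from_prod_countable_right fun f' => Finset.measurable_sum _ fun h _ =>
    Measurable.iSup fun f => ((measurable_avgLoss f h).sub_const (meanLoss D f' f h)).pow_const 2

theorem measurable_potential (D : POMDP S O A H) (t : ℕ) :
    Measurable (potential D : Run Pol 𝒢 N t → ℝ) := by
  have hv : Measurable (fun f : Hyp Pol 𝒢 => f.predValue D) := measurable_from_top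
  refine Finset.measurable_sum _ fun j _ => Measurable.add
    (measurable_const.sub (hv.comp (by fun_prop)))
    (Finset.measurable_sum _ fun h _ => Finset.measurable_sum _ fun s _ => Measurable.pow_const
      ((measurable_avgLoss_uncurry h).comp (f := fun ω : Run Pol 𝒢 N t => ((ω j).1, (ω s).2))
        (by fun_prop)) 2)

omit [Fintype A] [MeasurableSingletonClass A] in
theorem measurable_snoc_run {t : ℕ} : Measurable
    (fun p : Run Pol 𝒢 N t × (Hyp Pol 𝒢 × Batch O A M H N) =>
      (Fin.snoc p.1 p.2 : Run Pol 𝒢 N (t + 1))) := by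
  refine measurable_pi_lambda _ fun i => ?_
  induction i using Fin.lastCases with
  | last => simpa using measurable_snd
  | cast j =>
    have h : Measurable fun p : Run Pol 𝒢 N t × (Hyp Pol 𝒢 × Batch O A M H N) => p.1 j := by
      fun_prop
    simpa using h

variable [Nonempty A]

instance (D : POMDP S O A H) : IsMarkovKernel (batchLaw D : Kernel (Hyp Pol 𝒢) (Batch O A M H N)) :=
  ⟨fun _ => inferInstanceAs (IsProbabilityMeasure (Measure.pi _))⟩

omit [MeasurableSingletonClass A] [Nonempty A] in
theorem weight_eq (D : POMDP S O A H) (γ η : ℝ) {t : ℕ} (ω : Run Pol 𝒢 N t) (f : Hyp Pol 𝒢) :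
    weight D γ η ω f = (1 / (Fintype.card (Hyp Pol 𝒢) : ℝ))
      * Real.exp (-(-(γ * f.predValue D) + η * cumLoss ω f)) := by
  unfold weight
  congr 2
  rw [← Finset.mul_sum]
  unfold cumLoss avgLoss
  ring

omit [MeasurableSingletonClass A] [Nonempty A] in
theorem weight_div_sum (D : POMDP S O A H) (γ η : ℝ) {t : ℕ} (ω : Run Pol 𝒢 N t)
    (f : Hyp Pol 𝒢) : weight D γ η ω f / ∑ f', weight D γ η ω f' =
      Real.exp (-(-(γ * f.predValue D) + η * cumLoss ω f))
        / ∑ f' : Hyp Pol 𝒢, Real.exp (-(-(γ * f'.predValue D) + η * cumLoss ω f')) := by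
  have : Nonempty (Hyp Pol 𝒢) := ⟨f⟩
  have hn : (0 : ℝ) < Fintype.card (Hyp Pol 𝒢) := by exact_mod_cast Fintype.card_pos
  simp only [weight_eq, ← Finset.mul_sum]
  rw [mul_div_mul_left _ _ (by positivity)]

instance [Nonempty (Hyp Pol 𝒢)] (D : POMDP S O A H) (γ η : ℝ) (t : ℕ) :
    IsMarkovKernel (posterior D γ η t : Kernel (Run Pol 𝒢 N t) (Hyp Pol 𝒢)) := by
  refine ⟨fun ω => ⟨?_⟩⟩
  change (∑ f, ENNReal.ofReal (weight D γ η ω f / ∑ f', weight D γ η ω f') • Measure.dirac f)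
    Set.univ = 1
  simp only [Measure.coe_finsetSum, Finset.sum_apply, Measure.smul_apply, smul_eq_mul,
    measure_univ, mul_one, weight_div_sum]
  rw [← ENNReal.ofReal_sum_of_nonneg fun f _ => by positivity, ← Finset.sum_div,
    div_self (Finset.sum_pos (fun f _ => Real.exp_pos _) Finset.univ_nonempty).ne',
    ENNReal.ofReal_one]

instance [Nonempty (Hyp Pol 𝒢)] (D : POMDP S O A H) (γ η : ℝ) (t : ℕ) : IsMarkovKernel
    (iteration D γ η t : Kernel (Run Pol 𝒢 N t) (Hyp Pol 𝒢 × Batch O A M H N)) := by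
  unfold iteration; infer_instance

instance [Nonempty (Hyp Pol 𝒢)] (D : POMDP S O A H) (γ η : ℝ) (t : ℕ) :
    IsProbabilityMeasure (runLaw D Pol 𝒢 N γ η t) := by
  induction t with
  | zero => unfold runLaw; infer_instance
  | succ t ih => exact Measure.isProbabilityMeasure_map measurable_snoc_run.aemeasurable

omit [Nonempty A] in
theorem integral_posterior (D : POMDP S O A H) (γ η : ℝ) {t : ℕ} (ω : Run Pol 𝒢 N t)
    (φ : Hyp Pol 𝒢 → ℝ) : ∫ f, φ f ∂(posterior D γ η t ω)
      = ∑ f, Real.exp (-(-(γ * f.predValue D) + η * cumLoss ω f))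
        / (∑ f' : Hyp Pol 𝒢, Real.exp (-(-(γ * f'.predValue D) + η * cumLoss ω f'))) * φ f := by
  change ∫ f, φ f ∂(∑ f, ENNReal.ofReal (weight D γ η ω f / ∑ f', weight D γ η ω f')
    • Measure.dirac f) = _
  rw [integral_finsetSum_measure fun f _ => ?_]
  · refine Finset.sum_congr rfl fun f _ => ?_
    rw [integral_smul_measure, integral_dirac, weight_div_sum,
      ENNReal.toReal_ofReal (by positivity), smul_eq_mul]
  · exact (Integrable.of_finite).smul_measure ENNReal.ofReal_ne_top

omit [Nonempty A] in
/-- The posterior trades the predicted value off against the empirical loss. -/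
theorem integral_posterior_gap_le (D : POMDP S O A H) {γ : ℝ} (hγ : 0 < γ) {t : ℕ}
    (ω : Run Pol 𝒢 N t) (f₀ : Hyp Pol 𝒢) :
    ∫ f, (f₀.predValue D - f.predValue D + cumLoss ω f) ∂(posterior D γ γ t ω)
      ≤ cumLoss ω f₀ + Real.log (Fintype.card (Hyp Pol 𝒢)) / γ := by
  have : Nonempty (Hyp Pol 𝒢) := ⟨f₀⟩
  have h1 := sum_gibbs_mul_le
    (fun f : Hyp Pol 𝒢 => -(γ * f.predValue D) + γ * cumLoss ω f) f₀
  rw [← integral_posterior D γ γ ω fun f => -(γ * f.predValue D) + γ * cumLoss ω f] at h1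
  -- Equality of the two rates lets the whole energy be divided by `γ`, so that gap and penalty both
  -- carry coefficient `1`.
  have h2 : ∫ f, (f₀.predValue D - f.predValue D + cumLoss ω f) ∂(posterior D γ γ t ω)
      = f₀.predValue D + (∫ f, (-(γ * f.predValue D) + γ * cumLoss ω f)
        ∂(posterior D γ γ t ω)) / γ := by
    rw [← integral_div]
    have h : ∀ f : Hyp Pol 𝒢, f₀.predValue D - f.predValue D + cumLoss ω f
        = f₀.predValue D + (-(γ * f.predValue D) + γ * cumLoss ω f) / γ := fun f => by
      field_simp; ring
    simp_rw [h]
    rw [integral_add (integrable_const _) .of_finite]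
    simp
  rw [h2]
  have h3 := div_le_div_of_nonneg_right h1 hγ.le
  have h4 : (-(γ * f₀.predValue D) + γ * cumLoss ω f₀ + Real.log (Fintype.card (Hyp Pol 𝒢))) / γ
      = -f₀.predValue D + cumLoss ω f₀ + Real.log (Fintype.card (Hyp Pol 𝒢)) / γ := by
    field_simp
  linarith

end Run

/-! ### Expectations over the run, and the regret in terms of the parameters -/

section Expectation

variable {S : Type w} {O : Type u} {A : Type v} [MeasurableSpace S] [MeasurableSpace O]
  [MeasurableSpace A] [Fintype A] [Nonempty A] [MeasurableSingletonClass A] {H M N : ℕ}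
  {Pol : Finset (MemPolicy O A M)} {𝒢 : Finset (LinkFn O A M H)}

omit [MeasurableSingletonClass A] in
theorem ae_regular_batchLaw (D : POMDP S O A H) (f : Hyp Pol 𝒢) :
    ∀ᵐ b ∂(batchLaw D f : Measure (Batch O A M H N)), Regular b := by
  change ∀ᵐ b ∂(Measure.pi fun h : Fin H => Measure.pi fun _ : Fin N =>
    D.sampleLaw (f.pol.explore h) h), Regular b
  simp only [Regular, ae_all_iff]
  intro h i
  have h1 : ∀ᵐ y ∂(Measure.pi fun _ : Fin N => D.sampleLaw (f.pol.explore h) h),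
      |(y i).2.2.1| ≤ 1 :=
    (Measure.tendsto_eval_ae_ae (μ := fun _ : Fin N => D.sampleLaw (f.pol.explore h) h)
      (i := i)).eventually (ae_abs_reward_sampleLaw_le D (f.pol.explore h) h.2)
  exact (Measure.tendsto_eval_ae_ae (μ := fun h : Fin H => Measure.pi fun _ : Fin N =>
    D.sampleLaw (f.pol.explore h) h) (i := h)).eventually
      (p := fun y : Fin N → Sample O A M h => |(y i).2.2.1| ≤ 1) h1

theorem integral_deviation_le {B : ℝ} (hB0 : 0 < B) (hB : ∀ g ∈ 𝒢, ∀ h z, |g.val h z| ≤ B)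
    (hN : 0 < N) (D : POMDP S O A H) (f : Hyp Pol 𝒢) :
    Integrable (fun b => deviation D (f, b)) (batchLaw D f : Measure (Batch O A M H N)) ∧
    ∫ b, deviation D (f, b) ∂(batchLaw D f : Measure (Batch O A M H N))
      ≤ H * (8 * lossBound A B ^ 2 * (1 + Real.log (Fintype.card (Hyp Pol 𝒢))) / N) := by
  have : Nonempty (Hyp Pol 𝒢) := ⟨f⟩
  have hm : ∀ h : Fin H, Measurable (fun y : Fin N → Sample O A M h => ⨆ f' : Hyp Pol 𝒢,
      ((1 / (N : ℝ)) * ∑ i, loss f' (y i) - meanLoss D f f' h) ^ 2) := fun h =>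
    Measurable.iSup fun f' => ((measurable_const.mul (Finset.measurable_sum _ fun i _ =>
      (measurable_loss f').comp (by fun_prop))).sub_const _).pow_const 2
  have hsup : ∀ h : Fin H, Integrable (fun b : Batch O A M H N =>
      ⨆ f', (avgLoss f' b h - meanLoss D f f' h) ^ 2) (batchLaw D f) := by
    intro h
    refine Integrable.of_bound ((hm h).comp (measurable_pi_apply h)).aestronglyMeasurable
      (H * (2 * lossBound A B) ^ 2) ((ae_regular_batchLaw D f).mono fun b hb => ?_)
    rw [Real.norm_eq_abs, abs_of_nonneg (Real.iSup_nonneg fun _ => sq_nonneg _)]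
    exact (Finset.single_le_sum
      (f := fun h => ⨆ f', (avgLoss f' b h - meanLoss D f f' h) ^ 2)
      (fun _ _ => Real.iSup_nonneg fun _ => sq_nonneg _) (Finset.mem_univ h)).trans
        (deviation_le hB0 hB D (f, b) hb)
  refine ⟨integrable_finsetSum _ fun h _ => hsup h, ?_⟩
  have hle : ∀ h ∈ (Finset.univ : Finset (Fin H)),
      ∫ b, ⨆ f', (avgLoss f' b h - meanLoss D f f' h) ^ 2
        ∂(batchLaw D f : Measure (Batch O A M H N))
      ≤ 8 * lossBound A B ^ 2 * (1 + Real.log (Fintype.card (Hyp Pol 𝒢))) / N := by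
    intro h _
    refine le_of_eq_of_le ?_ (integral_iSup_sq_average_le
      (P := D.sampleLaw (f.pol.explore h) h) hN
      (X := fun f' : Hyp Pol 𝒢 => loss f') (fun f' => measurable_loss f') (lossBound_pos hB0)
      fun f' => (ae_abs_reward_sampleLaw_le D (f.pol.explore h) h.2).mono
        fun ζ hζ => abs_loss_le hB f' ζ hζ)
    -- The term of step `h` involves only the `h`-th marginal of the batch law, which is an `N`-fold
    -- i.i.d. product.
    exact integral_comp_eval (μ := fun h : Fin H => Measure.pi fun _ : Fin N =>
      D.sampleLaw (f.pol.explore h) h) (hm h).aestronglyMeasurable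
  unfold deviation
  rw [integral_finsetSum _ fun h _ => hsup h]
  simpa using Finset.sum_le_sum hle

theorem ae_regular_runLaw (D : POMDP S O A H) (γ η : ℝ) (t : ℕ) :
    ∀ᵐ ω ∂(runLaw D Pol 𝒢 N γ η t), ∀ s, Regular (ω s).2 := by
  induction t with
  | zero => exact .of_forall fun ω s => s.elim0
  | succ t ih =>
    have hms : ∀ t, MeasurableSet {ω : Run Pol 𝒢 N t | ∀ s, Regular (ω s).2} := fun t => by
      simp only [Set.ofPred_forall]
      exact .iInter fun s => measurableSet_regular.preimage (f := fun ω : Run Pol 𝒢 N t => (ω s).2)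
        (by fun_prop)
    unfold runLaw
    rw [ae_map_iff measurable_snoc_run.aemeasurable (hms _)]
    refine Measure.ae_compProd_of_ae_ae (measurable_snoc_run (hms _)) (ih.mono fun ω hω => ?_)
    have h2 : ∀ᵐ x ∂(iteration D γ η t ω : Measure (Hyp Pol 𝒢 × Batch O A M H N)),
        Regular x.2 := by
      unfold iteration
      exact Kernel.ae_compProd_of_ae_ae (measurable_snd measurableSet_regular)
        (.of_forall fun f => ae_regular_batchLaw D f)
    refine h2.mono fun x hx s => ?_
    induction s using Fin.lastCases with
    | last => simpa using hx
    | cast s => simpa using hω s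

variable [Nonempty (Hyp Pol 𝒢)]

theorem integrable_runLaw (D : POMDP S O A H) (γ η : ℝ) {t : ℕ} {F : Run Pol 𝒢 N t → ℝ} {C : ℝ}
    (hF : Measurable F) (hC : ∀ ω, (∀ s, Regular (ω s).2) → |F ω| ≤ C) :
    Integrable F (runLaw D Pol 𝒢 N γ η t) :=
  Integrable.of_bound hF.aestronglyMeasurable C
    ((ae_regular_runLaw D γ η t).mono fun ω hω => hC ω hω)

/-- The tower property for the last iteration of a run. -/
theorem integral_runLaw_succ_le (D : POMDP S O A H) (γ η : ℝ) {t : ℕ}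
    {F : Run Pol 𝒢 N (t + 1) → ℝ} {G : Run Pol 𝒢 N t → ℝ}
    (hF : Integrable F (runLaw D Pol 𝒢 N γ η (t + 1)))
    (hG : Integrable G (runLaw D Pol 𝒢 N γ η t))
    (hle : ∀ ω, ∫ f, ∫ b, F (Fin.snoc ω (f, b)) ∂(batchLaw D f) ∂(posterior D γ η t ω) ≤ G ω) :
    ∫ ω, F ω ∂(runLaw D Pol 𝒢 N γ η (t + 1)) ≤ ∫ ω, G ω ∂(runLaw D Pol 𝒢 N γ η t) := by
  rw [show runLaw D Pol 𝒢 N γ η (t + 1) = (runLaw D Pol 𝒢 N γ η t ⊗ₘ iteration D γ η t).map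
    (fun p => (Fin.snoc p.1 p.2 : Run Pol 𝒢 N (t + 1))) from rfl] at hF ⊢
  have hi : Integrable (fun p : Run Pol 𝒢 N t × (Hyp Pol 𝒢 × Batch O A M H N) =>
      F (Fin.snoc p.1 p.2)) (runLaw D Pol 𝒢 N γ η t ⊗ₘ iteration D γ η t) := (integrable_map_measure hF.1 measurable_snoc_run.aemeasurable).1 hF
  rw [integral_map measurable_snoc_run.aemeasurable hF.1, Measure.integral_compProd hi]
  have hi' := Integrable.integral_compProd (κ := Kernel.const Unit (runLaw D Pol 𝒢 N γ η t))
    (η := Kernel.prodMkLeft Unit (iteration D γ η t)) (a := ()) hi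
  refine integral_mono_ae hi' hG ?_
  -- Splitting the integral over the iteration kernel needs integrability of the section at `ω`,
  -- which holds for almost every `ω`.
  filter_upwards [((Measure.integrable_compProd_iff hi.1).1 hi).1] with ω hω
  refine le_of_eq_of_le ?_ (hle ω)
  unfold iteration at hω ⊢
  exact ProbabilityTheory.integral_compProd hω

variable {B : ℝ} (hB0 : 0 < B) (hB : ∀ g ∈ 𝒢, ∀ h z, |g.val h z| ≤ B)

include hB0 hB in
theorem integrable_sum_deviation (D : POMDP S O A H) (γ η : ℝ) (t : ℕ) :
    Integrable (fun ω : Run Pol 𝒢 N t => ∑ s, deviation D (ω s))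
      (runLaw D Pol 𝒢 N γ η t) := by
  refine integrable_runLaw (C := t * (H * (2 * lossBound A B) ^ 2)) D γ η
    (Finset.measurable_sum _ fun s _ => (measurable_deviation D).comp (measurable_pi_apply s))
    fun ω hω => ?_
  rw [abs_of_nonneg (Finset.sum_nonneg fun s _ => deviation_nonneg D _)]
  simpa using Finset.sum_le_sum fun s (_ : s ∈ Finset.univ) =>
    deviation_le hB0 hB D (ω s) (hω s)

include hB0 hB in
theorem integrable_potential (D : POMDP S O A H) (γ η : ℝ) (t : ℕ) :
    Integrable (potential D : Run Pol 𝒢 N t → ℝ) (runLaw D Pol 𝒢 N γ η t) := by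
  obtain ⟨C, hC⟩ := (Set.finite_range fun f : Hyp Pol 𝒢 =>
    |optValue D Pol - f.predValue D|).bddAbove
  refine integrable_runLaw (C := t * (C + H * (t * lossBound A B ^ 2))) D γ η
    (measurable_potential D t) fun ω hω => (Finset.abs_sum_le_sum_abs _ _).trans ?_
  have : ∀ j ∈ (Finset.univ : Finset (Fin t)), |optValue D Pol - (ω j).1.predValue D
      + ∑ h, ∑ s ∈ Finset.Iio j, avgLoss (ω j).1 (ω s).2 h ^ 2|
      ≤ C + H * (t * lossBound A B ^ 2) := by
    intro j _
    refine (abs_add_le _ _).trans (add_le_add (hC ⟨_, rfl⟩) ?_)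
    rw [abs_of_nonneg (by positivity)]
    have h1 : ∀ h ∈ (Finset.univ : Finset (Fin H)),
        ∑ s ∈ Finset.Iio j, avgLoss (ω j).1 (ω s).2 h ^ 2 ≤ t * lossBound A B ^ 2 := by
      intro h _
      refine (Finset.sum_le_univ_sum_of_nonneg fun s => sq_nonneg _).trans ?_
      simpa using Finset.sum_le_sum fun s (_ : s ∈ Finset.univ) =>
        avgLoss_sq_le hB0 hB (ω j).1 (hω s) h
    simpa using Finset.sum_le_sum h1
  simpa [mul_add] using Finset.sum_le_sum this

include hB0 hB in
theorem integral_sum_deviation_le (hN : 0 < N) (D : POMDP S O A H) (γ η : ℝ) (t : ℕ) :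
    ∫ ω, ∑ s, deviation D (ω s) ∂(runLaw D Pol 𝒢 N γ η t) ≤
      t * (H * (8 * lossBound A B ^ 2 * (1 + Real.log (Fintype.card (Hyp Pol 𝒢))) / N)) := by
  set δ := H * (8 * lossBound A B ^ 2 * (1 + Real.log (Fintype.card (Hyp Pol 𝒢))) / N)
  induction t with
  | zero => simp
  | succ t ih =>
    refine (integral_runLaw_succ_le D γ η (G := fun ω => (∑ s, deviation D (ω s)) + δ)
      (integrable_sum_deviation hB0 hB D γ η (t + 1))
      ((integrable_sum_deviation hB0 hB D γ η t).add (integrable_const _)) fun ω => ?_).trans ?_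
    · have h1 : ∀ f : Hyp Pol 𝒢, ∫ b, ∑ s, deviation D
          ((Fin.snoc ω (f, b) : Run Pol 𝒢 N (t + 1)) s) ∂(batchLaw D f)
          ≤ (∑ s, deviation D (ω s)) + δ := by
        intro f
        obtain ⟨hi, hle⟩ := integral_deviation_le (N := N) hB0 hB hN D f
        simp only [Fin.sum_univ_castSucc, Fin.snoc_castSucc, Fin.snoc_last]
        rw [integral_add (integrable_const _) hi]
        simpa using hle
      refine (integral_mono .of_finite (integrable_const _) h1).trans_eq ?_
      simp
    · rw [integral_add (integrable_sum_deviation hB0 hB D γ η t) (integrable_const _)]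
      push_cast
      simp only [integral_const, probReal_univ, one_smul]
      linarith

include hB0 hB in
-- The new term of the potential has conditional mean at most the accumulated deviation plus `log n
-- / γ`. The horizon `T` stays fixed in the induction on `t`, so that the expected deviation `t δ`
-- can be replaced by the uniform `T δ`.
theorem integral_potential_le (hN : 0 < N) (D : POMDP S O A H) {γ : ℝ} (hγ : 0 < γ)
    {f₀ : Hyp Pol 𝒢} (hv : f₀.predValue D = optValue D Pol)
    (hf₀ : ∀ f' h, meanLoss D f' f₀ h = 0) {t T : ℕ} (htT : t ≤ T) :
    ∫ ω, potential D ω ∂(runLaw D Pol 𝒢 N γ γ t) ≤ t * (T * (H * (8 * lossBound A B ^ 2 *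
      (1 + Real.log (Fintype.card (Hyp Pol 𝒢))) / N))
        + Real.log (Fintype.card (Hyp Pol 𝒢)) / γ) := by
  have hdev := integral_sum_deviation_le (Pol := Pol) (𝒢 := 𝒢) hB0 hB hN D γ γ
  have hδ : 0 ≤ H * (8 * lossBound A B ^ 2 *
      (1 + Real.log (Fintype.card (Hyp Pol 𝒢))) / N) := by
    have : 0 ≤ Real.log (Fintype.card (Hyp Pol 𝒢)) := Real.log_natCast_nonneg _
    positivity
  set δ := H * (8 * lossBound A B ^ 2 * (1 + Real.log (Fintype.card (Hyp Pol 𝒢))) / N)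
  set ε := Real.log (Fintype.card (Hyp Pol 𝒢)) / γ with hε
  induction t with
  | zero => simp [potential]
  | succ t ih =>
    have hip := integrable_potential (N := N) (Pol := Pol) hB0 hB D γ γ t
    have hid := integrable_sum_deviation (N := N) (Pol := Pol) hB0 hB D γ γ t
    refine (integral_runLaw_succ_le D γ γ
      (G := fun ω => potential D ω + ((∑ s, deviation D (ω s)) + ε))
      (integrable_potential hB0 hB D γ γ (t + 1))
      (hip.add (hid.add (integrable_const _))) fun ω => ?_).trans ?_
    · simp only [potential_snoc, integral_const, probReal_univ, one_smul]
      rw [integral_add (integrable_const _) .of_finite]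
      simp only [integral_const, probReal_univ, one_smul]
      have h1 := integral_posterior_gap_le D hγ ω f₀
      rw [hv, ← hε] at h1
      have h2 := cumLoss_le_sum_deviation D ω hf₀
      linarith
    · have hi : Integrable (fun ω : Run Pol 𝒢 N t => (∑ s, deviation D (ω s)) + ε)
          (runLaw D Pol 𝒢 N γ γ t) := hid.add (integrable_const _)
      rw [integral_add hip hi, integral_add hid (integrable_const _)]
      simp only [integral_const, probReal_univ, one_smul]
      have h1 := ih (by omega)
      have h2 := hdev t
      have h3 : (t : ℝ) * δ ≤ T * δ := by gcongr; omega
      push_cast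
      linarith

omit [Nonempty (Hyp Pol 𝒢)] [MeasurableSingletonClass A] in
/-- The generalized eluder coefficient bounds the regret along every run. -/
theorem sum_value_gap_le (D : POMDP S O A H) {T : ℕ} {ε d : ℝ} (hd : IsGEC D Pol 𝒢 T ε d)
    (ω : Run Pol 𝒢 N T) : ∑ t, (optValue D Pol - D.value (ω t).1.pol) ≤
      potential D ω + T * ∑ s, deviation D (ω s) + 5 / 2 * d + ε * H * T := by
  obtain ⟨⟨hd0, hd⟩, -⟩ := hd
  have h1 := hd fun t => (ω t).1
  set X := ∑ h : Fin H, ∑ t, ∑ s ∈ Finset.Iio t,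
    (∫ ζ, loss (ω t).1 ζ ∂(D.sampleLaw ((ω s).1.pol.explore h) h)) ^ 2 with hX
  have hX0 : 0 ≤ X := by positivity
  -- With these AM-GM weights the squared empirical losses end up with coefficient `1`, exactly the
  -- penalty in `potential`; `d/2` and the burn-in `2d` give `5/2 * d`.
  have hsqrt : Real.sqrt (d * X) ≤ d / 2 + X / 2 :=
    Real.sqrt_le_iff.2 ⟨by positivity, by nlinarith [sq_nonneg (d - X)]⟩
  have hXle : X ≤ 2 * (∑ t, ∑ h, ∑ s ∈ Finset.Iio t, avgLoss (ω t).1 (ω s).2 h ^ 2)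
      + 2 * (T * ∑ s, deviation D (ω s)) := by
    have hterm : ∀ t h s, meanLoss D (ω s).1 (ω t).1 h ^ 2
        ≤ 2 * avgLoss (ω t).1 (ω s).2 h ^ 2
          + 2 * ⨆ f, (avgLoss f (ω s).2 h - meanLoss D (ω s).1 f h) ^ 2 := by
      intro t h s
      have := sq_sub_le_iSup D (ω s) (ω t).1 h
      nlinarith [sq_nonneg (2 * avgLoss (ω t).1 (ω s).2 h - meanLoss D (ω s).1 (ω t).1 h)]
    have hdev : (T : ℝ) * ∑ s, deviation D (ω s) = ∑ h, ∑ _t : Fin T, ∑ s,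
        ⨆ f, (avgLoss f (ω s).2 h - meanLoss D (ω s).1 f h) ^ 2 := by
      unfold deviation
      rw [Finset.sum_comm (s := (Finset.univ : Finset (Fin T))), Finset.mul_sum]
      simp
    rw [hdev, Finset.sum_comm (s := (Finset.univ : Finset (Fin T))), Finset.mul_sum,
      Finset.mul_sum, ← Finset.sum_add_distrib]
    refine Finset.sum_le_sum fun h _ => ?_
    rw [Finset.mul_sum, Finset.mul_sum, ← Finset.sum_add_distrib]
    refine Finset.sum_le_sum fun t _ => ?_
    refine (Finset.sum_le_sum fun s _ => hterm t h s).trans ?_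
    rw [Finset.sum_add_distrib, ← Finset.mul_sum, ← Finset.mul_sum]
    -- The sum over `s < t` of the nonnegative suprema is enlarged to all `s`; this produces the
    -- factor `T`.
    gcongr
    · exact fun _ _ _ => Real.iSup_nonneg fun _ => sq_nonneg _
    · exact Finset.subset_univ _
  have hmin : min d (H * T) ≤ d := min_le_left _ _
  have hsplit : ∑ t, (optValue D Pol - D.value (ω t).1.pol)
      = ∑ t, ((ω t).1.predValue D - D.value (ω t).1.pol)
        + ∑ t, (optValue D Pol - (ω t).1.predValue D) := by
    rw [← Finset.sum_add_distrib]
    exact Finset.sum_congr rfl fun t _ => by ring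
  unfold potential
  rw [Finset.sum_add_distrib, hsplit]
  linarith

include hB0 hB in
theorem expectedRegret_le (hN : 0 < N) (D : POMDP S O A H) {γ : ℝ} (hγ : 0 < γ)
    {f₀ : Hyp Pol 𝒢} (hv : f₀.predValue D = optValue D Pol)
    (hf₀ : ∀ f' h, meanLoss D f' f₀ h = 0) {T : ℕ} {ε d : ℝ} (hd : IsGEC D Pol 𝒢 T ε d) :
    expectedRegret D Pol 𝒢 N T γ γ ≤ H * N * (2 * (T * (T * (H * (8 * lossBound A B ^ 2 *
      (1 + Real.log (Fintype.card (Hyp Pol 𝒢))) / N))))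
        + T * (Real.log (Fintype.card (Hyp Pol 𝒢)) / γ) + 5 / 2 * d + ε * H * T) := by
  have hip := integrable_potential (N := N) (Pol := Pol) hB0 hB D γ γ T
  have hid := integrable_sum_deviation (N := N) (Pol := Pol) hB0 hB D γ γ T
  have hreg : ∀ ω : Run Pol 𝒢 N T, regret D ω = H * N *
      ∑ t, (optValue D Pol - D.value (ω t).1.pol) := fun ω => by
    simp only [regret, Finset.sum_const, Finset.card_univ, Fintype.card_fin, nsmul_eq_mul,
      Finset.mul_sum, mul_assoc]
  have hval : Measurable (fun f : Hyp Pol 𝒢 => D.value f.pol) := measurable_from_top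
  obtain ⟨C, hC⟩ := (Set.finite_range fun f : Hyp Pol 𝒢 =>
    |optValue D Pol - D.value f.pol|).bddAbove
  have hir : Integrable (fun ω : Run Pol 𝒢 N T =>
      ∑ t, (optValue D Pol - D.value (ω t).1.pol)) (runLaw D Pol 𝒢 N γ γ T) :=
    integrable_finsetSum _ fun t _ => integrable_of_measurable_of_abs_le (C := C)
      (measurable_const.sub (hval.comp (by fun_prop))) fun ω => hC ⟨_, rfl⟩
  unfold expectedRegret
  simp_rw [hreg]
  rw [integral_const_mul]
  gcongr
  have hi1 : Integrable (fun ω : Run Pol 𝒢 N T => potential D ω + T * ∑ s, deviation D (ω s))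
    (runLaw D Pol 𝒢 N γ γ T) := hip.add (hid.const_mul _)
  have hi2 : Integrable (fun ω : Run Pol 𝒢 N T => potential D ω + T * ∑ s, deviation D (ω s)
    + 5 / 2 * d) (runLaw D Pol 𝒢 N γ γ T) := hi1.add (integrable_const _)
  refine (integral_mono hir (hi2.add (integrable_const _)) fun ω =>
    sum_value_gap_le D hd ω).trans ?_
  simp only [Pi.add_apply]
  rw [integral_add hi2 (integrable_const _), integral_add hi1 (integrable_const _),
    integral_add hip (hid.const_mul _), integral_const_mul]
  simp only [integral_const, probReal_univ, one_smul]
  have h1 := integral_potential_le (N := N) hB0 hB hN D hγ hv hf₀ (le_refl T)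
  have h2 := mul_le_mul_of_nonneg_left (integral_sum_deviation_le (N := N) (Pol := Pol) (𝒢 := 𝒢)
    hB0 hB hN D γ γ T) (Nat.cast_nonneg (α := ℝ) T)
  linarith

end Expectation

/-! ### Arithmetic of the parameter choice -/

theorem exists_pow_three_eq {x : ℝ} (hx : 0 < x) : ∃ y : ℝ, 0 < y ∧ y ^ 3 = x := by
  refine ⟨x ^ (1 / 3 : ℝ), by positivity, ?_⟩
  rw [← Real.rpow_natCast, ← Real.rpow_mul hx.le]
  norm_num

theorem pow_three_rpow_one_third {y : ℝ} (hy : 0 ≤ y) : (y ^ 3) ^ (1 / 3 : ℝ) = y := by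
  rw [← Real.rpow_natCast, ← Real.rpow_mul hy]
  norm_num

theorem pow_three_rpow_two_thirds {y : ℝ} (hy : 0 ≤ y) : (y ^ 3) ^ (2 / 3 : ℝ) = y ^ 2 := by
  rw [← Real.rpow_natCast, ← Real.rpow_mul hy, ← Real.rpow_natCast]
  norm_num

theorem lossBound_le {A : Type*} [Fintype A] [Nonempty A] {B : ℝ} (hB : 0 < B) :
    lossBound A B ≤ (1 + 2 * B) * Fintype.card A := by
  have : (1 : ℝ) ≤ Fintype.card A := by exact_mod_cast Fintype.card_pos
  unfold lossBound
  nlinarith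

/-- The regret bound for the stated batch size, number of iterations and learning rate. -/
theorem regret_bound_le {B κ c N T H A d ι ln b γ K : ℝ} (hB : 0 < B) (hκ : 1 ≤ κ) (hc : 0 < c)
    (hN : 0 < N) (hT : 0 < T) (hH : 1 ≤ H) (hA : 1 ≤ A) (hK1 : 1 ≤ K) (hK : K = N * T * H)
    (hd : c ≤ d * A * H) (hln : 0 < ln) (hι : 1 / 2 ≤ ι) (hlnι : ln ≤ ι)
    (hb0 : 0 ≤ b) (hb : b ≤ (1 + 2 * B) * A)
    (hNle : N ≤ κ * ((A ^ 2 * ι / (d * H)) ^ (1 / 3 : ℝ) * K ^ (2 / 3 : ℝ)))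
    (hTle : T ≤ κ * ((d / (ι * A ^ 2 * H ^ 2)) ^ (1 / 3 : ℝ) * K ^ (1 / 3 : ℝ)))
    (hγ : γ = K ^ (1 / 3 : ℝ) * ln) :
    H * N * (2 * (T * (T * (H * (8 * b ^ 2 * (1 + ln) / N)))) + T * (ln / γ) + 5 / 2 * d
        + 1 / (H * K) * H * T)
      ≤ (48 * (1 + 2 * B) ^ 2 * κ ^ 2 + 5 / 2 * κ + 4 * (c ^ (2 / 3 : ℝ))⁻¹)
        * ((d * A * H * K) ^ (2 / 3 : ℝ) * ι ^ (1 / 3 : ℝ)) := by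
  have hι0 : 0 < ι := by linarith
  have hd0 : 0 < d := by
    by_contra h
    have : d * A * H ≤ 0 := by
      rw [mul_assoc]; exact mul_nonpos_of_nonpos_of_nonneg (not_lt.1 h) (by positivity)
    linarith
  -- Replacing each parameter by the cube of its cube root makes every fractional power a monomial.
  obtain ⟨x, hx, rfl⟩ := exists_pow_three_eq hd0
  obtain ⟨a, ha, rfl⟩ := exists_pow_three_eq (show 0 < A by linarith)
  obtain ⟨h, hh, rfl⟩ := exists_pow_three_eq (show 0 < H by linarith)
  obtain ⟨k, hk, rfl⟩ := exists_pow_three_eq (show 0 < K by linarith)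
  obtain ⟨i, hi, rfl⟩ := exists_pow_three_eq hι0
  obtain ⟨e, he, rfl⟩ := exists_pow_three_eq hc
  rw [show (a ^ 3) ^ 2 * i ^ 3 / (x ^ 3 * h ^ 3) = (a ^ 2 * i / (x * h)) ^ 3 by
    field_simp, pow_three_rpow_one_third (by positivity),
    pow_three_rpow_two_thirds hk.le] at hNle
  rw [show x ^ 3 / (i ^ 3 * (a ^ 3) ^ 2 * (h ^ 3) ^ 2) = (x / (i * a ^ 2 * h ^ 2)) ^ 3 by
    field_simp, pow_three_rpow_one_third (by positivity),
    pow_three_rpow_one_third hk.le] at hTle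
  rw [pow_three_rpow_one_third hk.le] at hγ
  rw [show x ^ 3 * a ^ 3 * h ^ 3 * k ^ 3 = (x * a * h * k) ^ 3 by ring,
    pow_three_rpow_two_thirds he.le, pow_three_rpow_two_thirds (by positivity),
    pow_three_rpow_one_third hi.le]
  have hk1 : 1 ≤ k := by
    by_contra hlt
    exact absurd hK1 (not_le.2 (pow_lt_one₀ hk.le (not_le.1 hlt) (by norm_num)))
  have hi1 : 1 / 2 ≤ i := by
    by_contra hlt
    have : i ^ 3 < (1 / 2) ^ 3 := pow_lt_pow_left₀ (not_le.1 hlt) hi.le (by norm_num)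
    norm_num at this
    linarith
  have hxah : e ≤ x * a * h := by
    refine le_of_pow_le_pow_left₀ (n := 3) (by norm_num) (by positivity) ?_
    rw [mul_pow, mul_pow]; exact hd
  set Q := (x * a * h * k) ^ 2 * i with hQ
  -- The batch size cancels. The constant is `48 = 16 · 3`, where `1 + ln ≤ 3ι` because `ι ≥ 1/2`
  -- and `ln ≤ ι`.
  have t1 : h ^ 3 * N * (2 * (T * (T * (h ^ 3 * (8 * b ^ 2 * (1 + ln) / N)))))
      ≤ 48 * (1 + 2 * B) ^ 2 * κ ^ 2 * Q := by
    calc _ = 16 * b ^ 2 * (1 + ln) * T ^ 2 * h ^ 6 := by field_simp; ring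
      _ ≤ 16 * ((1 + 2 * B) * a ^ 3) ^ 2 * (3 * i ^ 3)
          * (κ * (x / (i * a ^ 2 * h ^ 2) * k)) ^ 2 * h ^ 6 := by
        gcongr
        linarith
      _ = _ := by rw [hQ]; field_simp; ring
  have t3 : h ^ 3 * N * (5 / 2 * x ^ 3) ≤ 5 / 2 * κ * Q := by
    calc _ ≤ h ^ 3 * (κ * (a ^ 2 * i / (x * h) * k ^ 2)) * (5 / 2 * x ^ 3) := by gcongr
      _ = _ := by rw [hQ]; field_simp
  -- The terms `t2` and `t4` are at most `K^{2/3}`, with no factor `d A H`; the lower bound `c`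
  -- supplies it, and `ι^{1/3} ≥ 1/2` costs the factor `2`.
  have hkQ : k ^ 2 ≤ 2 * (e ^ 2)⁻¹ * Q := by
    rw [mul_assoc, mul_comm (e ^ 2)⁻¹, ← div_eq_mul_inv, ← mul_div_assoc, le_div_iff₀ (by positivity)]
    calc k ^ 2 * e ^ 2 ≤ k ^ 2 * (x * a * h) ^ 2 * (2 * i) := by
          rw [← mul_one (k ^ 2 * e ^ 2)]
          gcongr
          linarith
      _ = _ := by rw [hQ]; ring
  have t2 : h ^ 3 * N * (T * (ln / γ)) = k ^ 2 := by
    have : h ^ 3 * N * T = k ^ 3 := by rw [hK]; ring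
    rw [← mul_assoc, this, hγ]
    field_simp
  have t4 : h ^ 3 * N * (1 / (h ^ 3 * k ^ 3) * h ^ 3 * T) ≤ k ^ 2 := by
    have : h ^ 3 * N * (1 / (h ^ 3 * k ^ 3) * h ^ 3 * T) = 1 := by
      rw [hK]; field_simp
    rw [this]
    exact one_le_pow₀ hk1
  linarith

theorem card_hyp {O : Type u} {A : Type v} [MeasurableSpace O] [MeasurableSpace A] {M H : ℕ}
    (Pol : Finset (MemPolicy O A M)) (𝒢 : Finset (LinkFn O A M H)) :
    Fintype.card (Hyp Pol 𝒢) = 𝒢.card * Pol.card := by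
  change Fintype.card (Pol × 𝒢) = _
  simp [mul_comm]

theorem expectedRegret_of_card_eq_one {S : Type w} {O : Type u} {A : Type v} [MeasurableSpace S]
    [MeasurableSpace O] [MeasurableSpace A] [Fintype A] [Nonempty A] [MeasurableSingletonClass A]
    {H M : ℕ} (D : POMDP S O A H) {Pol : Finset (MemPolicy O A M)}
    (𝒢 : Finset (LinkFn O A M H)) (N T : ℕ) (γ η : ℝ) (h : Pol.card = 1) :
    expectedRegret D Pol 𝒢 N T γ η = 0 := by
  obtain ⟨π, rfl⟩ := Finset.card_eq_one.1 h
  have hv : ∀ f : Hyp {π} 𝒢, D.value f.pol = D.value π := fun f => by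
    rw [show f.pol = π from Finset.mem_singleton.1 f.1.2]
  have ho : optValue D {π} = D.value π := by simp [optValue]
  simp [expectedRegret, regret, hv, ho]

end POB

end

theorem mainTheorem6 (B κ c : ℝ) (hB : 0 < B) (hκ : 1 ≤ κ) (hc : 0 < c) :
    ∃ C : ℝ, 0 < C ∧
      ∀ (S : Type w) (O : Type u) (A : Type v) (V : Type x)
        [MeasurableSpace S] [MeasurableSpace O] [MeasurableSpace A]
        [Fintype A] [Nonempty A] [MeasurableSingletonClass A]
        [NormedAddCommGroup V] [InnerProductSpace ℝ V] [CompleteSpace V]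
        (H M : ℕ) (D : POB.POMDP S O A H)
        (Pol : Finset (POB.MemPolicy O A M)) (𝒢 : Finset (POB.LinkFn O A M H))
        (N T K : ℕ) (d ι γ η : ℝ),
        0 < H → 0 < M → 0 < N → 0 < T →
        Pol.Nonempty →
        (∀ g ∈ 𝒢, ∀ h z, |g.val h z| ≤ B) →
        D.IsPOBilinear Pol 𝒢 V →
        K = N * T * H →
        POB.IsGEC D Pol 𝒢 T (1 / ((H : ℝ) * K)) d →
        c ≤ d * Fintype.card A * H →
        ι = Real.log (𝒢.card * Pol.card * H * (K : ℝ) ^ 2) →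
        (N : ℝ) ∈ Set.Icc
          (κ⁻¹ * (((Fintype.card A : ℝ) ^ 2 * ι / (d * H)) ^ (1 / 3 : ℝ) * (K : ℝ) ^ (2 / 3 : ℝ)))
          (κ * (((Fintype.card A : ℝ) ^ 2 * ι / (d * H)) ^ (1 / 3 : ℝ) * (K : ℝ) ^ (2 / 3 : ℝ))) →
        (T : ℝ) ∈ Set.Icc
          (κ⁻¹ * ((d / (ι * (Fintype.card A : ℝ) ^ 2 * (H : ℝ) ^ 2)) ^ (1 / 3 : ℝ)
            * (K : ℝ) ^ (1 / 3 : ℝ)))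
          (κ * ((d / (ι * (Fintype.card A : ℝ) ^ 2 * (H : ℝ) ^ 2)) ^ (1 / 3 : ℝ)
            * (K : ℝ) ^ (1 / 3 : ℝ))) →
        γ = (K : ℝ) ^ (1 / 3 : ℝ) * Real.log (𝒢.card * Pol.card) →
        η = (K : ℝ) ^ (1 / 3 : ℝ) * Real.log (𝒢.card * Pol.card) →
        POB.expectedRegret D Pol 𝒢 N T γ η ≤
          C * ((d * Fintype.card A * H * K) ^ (2 / 3 : ℝ) * ι ^ (1 / 3 : ℝ)) := by
  refine ⟨48 * (1 + 2 * B) ^ 2 * κ ^ 2 + 5 / 2 * κ + 4 * (c ^ (2 / 3 : ℝ))⁻¹, by positivity, ?_⟩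
  intro S O A V _ _ _ _ _ _ _ _ _ H M D Pol 𝒢 N T K d ι γ η hH hM hN hT hne hG hD hK hd hcd hι
    hNi hTi hγ hη
  obtain ⟨f₀, hv, hf₀⟩ := POB.exists_optimal_hyp D hH hG hne hD
  have : Nonempty (POB.Hyp Pol 𝒢) := ⟨f₀⟩
  have hK1 : 1 ≤ K := by rw [hK]; exact Nat.succ_le_of_lt (by positivity)
  have hcard := POB.card_hyp Pol 𝒢
  have hn : 0 < 𝒢.card * Pol.card := hcard ▸ Fintype.card_pos
  have hH' : (1 : ℝ) ≤ H := by exact_mod_cast hH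
  have hK' : (1 : ℝ) ≤ K := by exact_mod_cast hK1
  have hlnι : Real.log (𝒢.card * Pol.card) ≤ ι := by
    rw [hι]
    have h0 : (0 : ℝ) < 𝒢.card * Pol.card := by exact_mod_cast hn
    refine Real.log_le_log h0 ?_
    rw [mul_assoc _ (H : ℝ)]
    exact le_mul_of_one_le_right h0.le (one_le_mul_of_one_le_of_one_le hH' (one_le_pow₀ hK'))
  -- With a single hypothesis `log n = 0`, so `γ = 0` and the Gibbs argument is void; but then there
  -- is only one policy and no regret. Otherwise `log n ≥ log 2 ≥ 1/2`.
  rcases Nat.eq_or_lt_of_le (Nat.succ_le_of_lt hn) with h1 | h2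
  · rw [POB.expectedRegret_of_card_eq_one D 𝒢 N T γ η (Nat.eq_one_of_mul_eq_one_left h1.symm)]
    have hι0 : 0 ≤ ι := by
      refine le_trans ?_ hlnι
      rw [← Nat.cast_mul, ← h1]
      simp
    have : 0 ≤ d * Fintype.card A * H := hc.le.trans hcd
    positivity
  · have hlog2 : 1 / 2 ≤ Real.log (𝒢.card * Pol.card) := by
      have h3 : (2 : ℝ) ≤ 𝒢.card * Pol.card := by exact_mod_cast h2
      linarith [Real.log_two_gt_d9, Real.log_le_log (by norm_num) h3]
    have hγ0 : 0 < γ := by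
      rw [hγ]
      have : 0 < Real.log (𝒢.card * Pol.card) := by linarith
      positivity
    obtain rfl : η = γ := hη.trans hγ.symm
    have hreg := POB.expectedRegret_le hB hG hN D hγ0 hv hf₀ hd
    rw [hcard, Nat.cast_mul] at hreg
    exact hreg.trans (POB.regret_bound_le hB hκ hc (by exact_mod_cast hN) (by exact_mod_cast hT)
      hH' (by exact_mod_cast Fintype.card_pos) hK' (by rw [hK]; push_cast; ring) hcd
      (by linarith) (by linarith) hlnι (POB.lossBound_pos hB).le (POB.lossBound_le hB)
      hNi.2 hTi.2 hγ)
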